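/- Let $r\ge 2$ and let $(G_1,o_1),\dots,(G_r,o_r)$ be rooted simple graphs, each connected, locally finite, quasi-transitive (the automorphism group of $G_i$ has finitely many vertex orbits) and with at least two vertices; write $V_i$ for the vertex set of $G_i$. The vertices of the free product $G=G_1*\dots*G_r$ are the finite words $x_1x_2\cdots x_n$ ($n\ge 0$) over the disjoint union of the sets $V_i\setminus\{o_i\}$ in which no two consecutive letters come from the same set $V_i\setminus\{o_i\}$; the empty word $o$ is the root, and each $o_i$ is identified with $o$. The edges of $G$ are the pairs $wx\sim wy$, where $x\sim y$ is an edge of some $G_i$ and $w$ is a word whose last letter (if any) is not from $V_i\setminus\{o_i\}$. Let $\sigma_n$ be the number of self-avoiding walks of length $n$ on $G$ starting at $o$. Exclude the case in which $r=2$ and $G_1,G_2$ are two finite stars with different numbers of leaves, each rooted at its centre (a single edge counts as a star with one leaf, rooted at either end). Then the connective constant $\mu(G)=\lim_{n\to\infty}\sigma_n^{1/n}$ exists and there is a constant $A_G>0$ such that $$\sigma_n\sim A_G\,\mu(G)^n ,\qquad\text{i.e. } \frac{\sigma_n}{A_G\,\mu(G)^n}\to 1 \text{ as } n\to\infty .$$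 Consequently the critical exponent of $G$ is $\gamma=1$: for real $\gamma$, there is a constant $A>0$ with $\sigma_n\sim A\,\mu(G)^n n^{1-\gamma}$ if and only if $\gamma=1$. -/

import Mathlib

open Filter Topology

namespace FreeProductSAW

universe u v

/-! ### Self-avoiding walks on a rooted graph -/

section Graph

variable {W : Type u}

/-- The number of `n`-step self-avoiding walks on `G` that start at `o`. -/
noncomputable def sawCount (G : SimpleGraph W) (o : W) (n : ℕ) : ℕ :=
  Nat.card (Σ x : W, {p : G.Walk o x // p.IsPath ∧ p.length = n})

/-- `μ` is the connective constant of the rooted graph `(G, o)`: the limit of `σ_n ^ (1 / n)`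
exists and equals `μ`. -/
def IsConnectiveConstant (G : SimpleGraph W) (o : W) (μ : ℝ) : Prop :=
  Tendsto (fun n : ℕ => (sawCount G o n : ℝ) ^ (1 / (n : ℝ))) atTop (𝓝 μ)

/-- `σ_n ∼ A μ ^ n n ^ (1 - γ)` for some constant `A > 0`, where `μ` is the connective constant. -/
def IsCriticalExponent (G : SimpleGraph W) (o : W) (γ : ℝ) : Prop :=
  ∃ μ : ℝ, IsConnectiveConstant G o μ ∧ ∃ A : ℝ, 0 < A ∧
    Tendsto (fun n : ℕ => (sawCount G o n : ℝ) / (A * μ ^ n * (n : ℝ) ^ (1 - γ))) atTop (𝓝 1)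

/-- The automorphism group acts with finitely many orbits. -/
def IsQuasiTransitive (G : SimpleGraph W) : Prop :=
  ∃ S : Set W, S.Finite ∧ ∀ x : W, ∃ s ∈ S, ∃ φ : G ≃g G, φ s = x

/-- Every edge contains `o`. A connected graph with this property is a star with centre `o`. -/
def IsStarAt (G : SimpleGraph W) (o : W) : Prop :=
  ∀ x y : W, G.Adj x y → x = o ∨ y = o

end Graph

/-! ### Free products of rooted graphs -/

section FreeProduct

variable {ι : Type u} {V : ι → Type v}

/-- The letters: the disjoint union of the sets `V i \ {o i}`. The type `τ` of a letter is its
first component. -/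
abbrev Letter (o : ∀ i, V i) : Type (max u v) :=
  Σ i : ι, {x : V i // x ≠ o i}

/-- The words `x₁ x₂ … xₙ` over the letters, `n ≥ 0`, with consecutive letters of different type. -/
def Word (o : ∀ i, V i) : Type (max u v) :=
  {l : List (Letter o) // l.IsChain fun a b => a.1 ≠ b.1}

/-- The empty word. -/
def Word.empty (o : ∀ i, V i) : Word o :=
  ⟨[], List.isChain_nil⟩

open Classical in
/-- A vertex of `V i` as a word with at most one letter; the root `o i` is the empty word. -/
noncomputable def single (o : ∀ i, V i) (i : ι) (x : V i) : List (Letter o) :=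
  if h : x = o i then [] else [⟨i, x, h⟩]

theorem single_injective (o : ∀ i, V i) (i : ι) : Function.Injective (single o i) := by
  intro x y h
  unfold single at h
  split_ifs at h with hx hy hy
  · rw [hx, hy]
  · simpa using h

/-- The free product of the rooted graphs `(G i, o i)`: the edges are `w x ∼ w y`, where `x ∼ y` is
an edge of `G i` and the word `w` does not end in a letter of type `i`. -/
def freeProduct (G : ∀ i, SimpleGraph (V i)) (o : ∀ i, V i) : SimpleGraph (Word o) where
  Adj a b := ∃ (w : Word o) (i : ι) (x y : V i),
    (∀ c ∈ w.1.getLast?, c.1 ≠ i) ∧ (G i).Adj x y ∧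
      a.1 = w.1 ++ single o i x ∧ b.1 = w.1 ++ single o i y
  symm := by
    constructor
    rintro a b ⟨w, i, x, y, hw, hxy, ha, hb⟩
    exact ⟨w, i, y, x, hw, hxy.symm, hb, ha⟩
  loopless := by
    constructor
    rintro a ⟨w, i, x, y, -, hxy, ha, hb⟩
    exact hxy.ne (single_injective o i (List.append_cancel_left (ha.symm.trans hb)))

end FreeProduct

end FreeProductSAW

/-! The free product is tree-like. When a self-avoiding walk from `o` first reaches a word `w`,
nothing in the cone of `w` (the words with prefix `w`) has been visited. Hence the walk splits
uniquely into blocks, each a nontrivial self-avoiding walk from the root in a copy of some `G i`,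
with consecutive blocks of different types; conversely, all such sequences of blocks occur. With `a
i` the series of nontrivial walks of `G i` and `N` the series of the free product, this gives `N *
(1 - ∑ a i / (1 + a i)) = 1` (`sawSeries_freeProduct`). Merging all factors but one into a single
series `b` turns this into `N * (1 - a * b) = (1 + a) * (1 + b)`.

Each `a i` is unbounded on its domain of convergence (`supercritical_sawSeries_sub_one`). If the
walk counts of `G i` never vanish, quasi-transitivity gives submultiplicativity and hence divergence
at the critical point; otherwise `a i` is a polynomial with a positive linear term. This property
survives merging (`Supercritical.combine`). Therefore `a * b` takes the value 1 at some `ρ` strictly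
inside its domain of convergence. Rescaled by `ρ`, it is a probability distribution with exponential
tails, and the renewal theorem (`renewal_tendsto`) gives a positive limit of `σ_n ρ ^ n`.

Aperiodicity holds as soon as `a` or `b` has a quadratic term, for then `a * b` charges both 2 and
3. This fails only for two stars rooted at their centres. With equal numbers `d` of leaves, `N = (1
+ d X) / (1 - d X)` is explicit; with different numbers, `σ_n ρ ^ n` oscillates with the parity of
`n`, which is the excluded case. -/

namespace FreeProductSAW

universe u v


/-! ### Self-avoiding walks as lists, and inequalities between their counts. -/

section Lists

variable {W : Type u} {G : SimpleGraph W}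

/-- The `n`-step self-avoiding walks from `o`, as lists of vertices read backwards: the head is the
endpoint and the last entry is `o`. -/
def saws (G : SimpleGraph W) (o : W) (n : ℕ) : Set (List W) :=
  {l | l.IsChain G.Adj ∧ l.Nodup ∧ l.length = n + 1 ∧ l.getLast? = some o}

theorem sawCount_eq_ncard (o : W) (n : ℕ) : sawCount G o n = (saws G o n).ncard := by
  rw [sawCount, ← Nat.card_coe_set_eq]
  have hmem : ∀ p : (Σ x : W, {p : G.Walk o x // p.IsPath ∧ p.length = n}),
      p.2.1.support.reverse ∈ saws G o n := by
    rintro ⟨x, p, hp, hn⟩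
    refine ⟨?_, ?_, ?_, ?_⟩
    · rw [List.isChain_reverse]
      exact p.isChain_adj_support.imp fun a b h => h.symm
    · rw [List.nodup_reverse]; exact (p.isPath_def).1 hp
    · simp [hn]
    · rw [List.getLast?_reverse]
      cases p <;> simp
  refine Nat.card_eq_of_bijective (fun p => ⟨p.2.1.support.reverse, hmem p⟩) ⟨?_, ?_⟩
  · rintro ⟨x, p, hp, hn⟩ ⟨y, q, hq, hm⟩ h
    have h' : p.support = q.support := by simpa using h
    have hxy : x = y := by
      have h1 := p.getLast_support
      have h2 := q.getLast_support
      simp only [h'] at h1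
      exact h1.symm.trans h2
    subst hxy
    have : p = q := SimpleGraph.Walk.ext_support h'
    subst this
    rfl
  · rintro ⟨l, hc, hnd, hlen, hlast⟩
    have hc' : l.reverse.IsChain G.Adj := by
      rw [List.isChain_reverse]
      exact hc.imp fun a b h => h.symm
    have hne : l.reverse ≠ [] := by
      intro h
      simp only [List.reverse_eq_nil_iff] at h
      simp [h] at hlen
    have hhead : l.reverse.head hne = o := by
      have : l.reverse.head? = some o := by rw [List.head?_reverse, hlast]
      rw [List.head?_eq_some_head hne] at this
      exact Option.some.inj this
    let p := SimpleGraph.Walk.ofSupport l.reverse hne hc'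
    have hp : p.support = l.reverse := SimpleGraph.Walk.support_ofSupport hne hc'
    refine ⟨⟨_, p.copy hhead rfl, ?_, ?_⟩, ?_⟩
    · rw [SimpleGraph.Walk.isPath_def, SimpleGraph.Walk.support_copy, hp, List.nodup_reverse]
      exact hnd
    · have := p.length_support
      rw [hp, List.length_reverse, hlen] at this
      simp only [SimpleGraph.Walk.length_copy]
      omega
    · apply Subtype.ext
      change (p.copy hhead rfl).support.reverse = l
      rw [SimpleGraph.Walk.support_copy, hp, List.reverse_reverse]

theorem mem_saws_zero {o : W} {l : List W} : l ∈ saws G o 0 ↔ l = [o] := by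
  constructor
  · rintro ⟨-, -, hlen, hlast⟩
    obtain ⟨a, rfl⟩ := List.length_eq_one_iff.1 (by simpa using hlen)
    simpa using hlast
  · rintro rfl
    simp [saws]

theorem cons_mem_saws {o x y : W} {t : List W} {n : ℕ} :
    x :: y :: t ∈ saws G o (n + 1) ↔ G.Adj x y ∧ x ∉ y :: t ∧ y :: t ∈ saws G o n := by
  simp only [saws, Set.mem_ofPred_eq, List.isChain_cons_cons, List.nodup_cons (a := x),
    List.length_cons, List.getLast?_cons_cons, Nat.add_right_cancel_iff]
  tauto

theorem exists_eq_cons_of_mem_saws {o : W} {l : List W} {n : ℕ} (h : l ∈ saws G o n) :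
    ∃ x t, l = x :: t := by
  cases l with
  | nil => simp [saws] at h
  | cons x t => exact ⟨x, t, rfl⟩

theorem exists_eq_cons_cons_of_mem_saws {o : W} {l : List W} {n : ℕ} (h : l ∈ saws G o (n + 1)) :
    ∃ x y t, l = x :: y :: t := by
  match l, h with
  | [], h => simp [saws] at h
  | [x], h => simp [saws] at h
  | x :: y :: t, _ => exact ⟨x, y, t, rfl⟩

theorem finite_saws (hfin : ∀ x, (G.neighborSet x).Finite) (o : W) (n : ℕ) :
    (saws G o n).Finite := by
  induction n with
  | zero =>
    refine (Set.finite_singleton [o]).subset fun l hl => ?_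
    exact mem_saws_zero.1 hl
  | succ n ih =>
    refine (ih.biUnion (t := fun l => ⋃ y ∈ {y | y ∈ l.head?}, (fun x => x :: l) '' G.neighborSet y)
      fun l _ => ?_).subset fun l hl => ?_
    · refine Set.Finite.biUnion ?_ fun y _ => (hfin y).image _
      cases l with
      | nil => simp
      | cons a l => simp
    · obtain ⟨x, y, t, rfl⟩ := exists_eq_cons_cons_of_mem_saws hl
      obtain ⟨hxy, -, ht⟩ := cons_mem_saws.1 hl
      simp only [Set.mem_iUnion]
      exact ⟨y :: t, ht, y, by simp, x, hxy.symm, rfl⟩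

theorem append_cons_mem_saws {o x : W} {A B : List W} {n : ℕ} (h : A ++ x :: B ∈ saws G o n) :
    A ++ [x] ∈ saws G x A.length ∧ x :: B ∈ saws G o B.length ∧ A.length + B.length = n := by
  obtain ⟨hc, hnd, hlen, hlast⟩ := h
  rw [List.isChain_split] at hc
  refine ⟨⟨hc.1, ?_, by simp, by simp⟩, ⟨hc.2, ?_, by simp, ?_⟩, ?_⟩
  · refine hnd.sublist ?_
    simp
  · exact hnd.sublist (List.sublist_append_right _ _)
  · simpa [List.getLast?_append] using hlast
  · simp at hlen; omega

theorem append_singleton_of_mem_saws {o : W} {l : List W} {n : ℕ} (h : l ∈ saws G o n) :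
    ∃ t, l = t ++ [o] ∧ t.length = n := by
  obtain ⟨-, -, hlen, hlast⟩ := h
  obtain ⟨t, rfl⟩ := List.getLast?_eq_some_iff.1 hlast
  exact ⟨t, rfl, by simpa using hlen⟩

theorem reverse_mem_saws {o x : W} {B : List W} {n : ℕ} (h : x :: B ∈ saws G o n) :
    (x :: B).reverse ∈ saws G x n := by
  obtain ⟨hc, hnd, hlen, hlast⟩ := h
  refine ⟨?_, List.nodup_reverse.2 hnd, by simpa using hlen, by simp⟩
  rw [List.isChain_reverse]
  exact hc.imp fun a b h => h.symm

/-- The self-avoiding walks of a locally finite graph as a finset. -/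
noncomputable def sawFinset (hfin : ∀ x, (G.neighborSet x).Finite) (o : W) (n : ℕ) :
    Finset (List W) :=
  (finite_saws hfin o n).toFinset

theorem mem_sawFinset (hfin : ∀ x, (G.neighborSet x).Finite) {o : W} {n : ℕ} {l : List W} :
    l ∈ sawFinset hfin o n ↔ l ∈ saws G o n := by
  simp [sawFinset]

theorem card_sawFinset (hfin : ∀ x, (G.neighborSet x).Finite) (o : W) (n : ℕ) :
    (sawFinset hfin o n).card = sawCount G o n := by
  rw [sawCount_eq_ncard, sawFinset, Set.ncard_eq_toFinset_card _ (finite_saws hfin o n)]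

theorem sawCount_zero (o : W) : sawCount G o 0 = 1 := by
  rw [sawCount_eq_ncard, Set.ncard_eq_one]
  exact ⟨[o], Set.ext fun l => mem_saws_zero⟩

theorem sawCount_one (o : W) : sawCount G o 1 = (G.neighborSet o).ncard := by
  rw [sawCount_eq_ncard]
  symm
  refine Set.ncard_congr (fun x _ => [x, o]) ?_ ?_ ?_
  · intro x hx
    rw [cons_mem_saws]
    refine ⟨SimpleGraph.Adj.symm hx, ?_, mem_saws_zero.2 rfl⟩
    simpa using (SimpleGraph.Adj.ne hx).symm
  · intro a b _ _ h
    simpa using h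
  · intro l hl
    obtain ⟨x, y, t, rfl⟩ := exists_eq_cons_cons_of_mem_saws hl
    obtain ⟨hxy, -, ht⟩ := cons_mem_saws.1 hl
    have := mem_saws_zero.1 ht
    obtain ⟨rfl, rfl⟩ : y = o ∧ t = [] := by simpa using this
    exact ⟨x, hxy.symm, rfl⟩

/-- Cut the walk after `m` steps. Lists run backwards, so `drop n` is the initial piece and `take (n
+ 1)` the final one, starting at the head of the initial piece. -/
theorem sawCount_add_le (hfin : ∀ x, (G.neighborSet x).Finite) (o : W) (m n S : ℕ)
    (hS : ∀ x, sawCount G x n ≤ S) : sawCount G o (m + n) ≤ sawCount G o m * S := by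
  classical
  rw [← card_sawFinset hfin, ← card_sawFinset hfin]
  have key : (sawFinset hfin o (m + n)).card ≤
      ((sawFinset hfin o m).sigma fun B => sawFinset hfin (B.headD o) n).card := by
    refine Finset.card_le_card_of_injOn (fun l => ⟨l.drop n, l.take (n + 1)⟩) ?_ ?_
    · intro l hl
      rw [Finset.mem_coe, mem_sawFinset] at hl
      have hn : n < l.length := by
        have := hl.2.2.1
        omega
      have hl' : l.take n ++ l[n] :: l.drop (n + 1) = l := by
        rw [List.getElem_cons_drop, List.take_append_drop]
      have hlen : (l.take n).length = n := by simp; omega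
      rw [← hl'] at hl
      obtain ⟨h1, h2, h3⟩ := append_cons_mem_saws hl
      rw [hlen] at h1 h3
      have h4 : (l.drop (n + 1)).length = m := by omega
      rw [h4] at h2
      simp only [Finset.coe_sigma, Set.mem_sigma_iff, Finset.mem_coe, mem_sawFinset]
      rw [← List.getElem_cons_drop hn]
      refine ⟨h2, ?_⟩
      rw [List.take_succ_eq_append_getElem hn]
      exact h1
    · intro l hl l' hl' h
      simp only [Sigma.mk.injEq, heq_eq_eq] at h
      rw [← List.take_append_drop n l, ← List.take_append_drop n l', h.1]
      have := congrArg (List.take n) h.2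
      rw [show List.take n l = List.take n l' by simpa [List.take_take] using this]
  refine key.trans ?_
  rw [Finset.card_sigma]
  refine (Finset.sum_le_card_nsmul _ _ S fun B _ => ?_).trans_eq (by simp)
  rw [card_sawFinset]
  exact hS _

/-- A walk from `v` avoiding `o` is prolonged backwards by the edge from `o` to `v`. One that visits
`o` is cut there, and its part from `v` to `o` is reversed, which leaves two walks from `o`. This
carries convergence of the walk series from a vertex to its neighbours. -/
theorem sawCount_le_of_adj (hfin : ∀ x, (G.neighborSet x).Finite) {o v : W} (h : G.Adj o v)
    (n : ℕ) : sawCount G v n ≤ sawCount G o (n + 1) +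
      ∑ k ∈ Finset.HasAntidiagonal.antidiagonal n, sawCount G o k.1 * sawCount G o k.2 := by
  classical
  have hsplit := Finset.card_filter_add_card_filter_not (s := sawFinset hfin v n) (fun l => o ∉ l)
  rw [card_sawFinset] at hsplit
  rw [← hsplit]
  refine add_le_add ?_ ?_
  · rw [← card_sawFinset hfin]
    refine Finset.card_le_card_of_injOn (fun l => l ++ [o]) ?_ ?_
    · intro l hl
      rw [Finset.mem_coe, Finset.mem_filter, mem_sawFinset] at hl
      obtain ⟨⟨hc, hnd, hlen, hlast⟩, ho⟩ := hl
      rw [Finset.mem_coe, mem_sawFinset]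
      refine ⟨?_, ?_, by simp [hlen], by simp⟩
      · rw [List.isChain_append]
        refine ⟨hc, by simp, ?_⟩
        intro x hx y hy
        rw [hlast] at hx
        simp only [Option.mem_some_iff] at hx
        simp only [List.head?_cons, Option.mem_some_iff] at hy
        rw [← hx, ← hy]
        exact h.symm
      · rw [List.nodup_append]
        refine ⟨hnd, by simp, ?_⟩
        intro a ha b hb
        simp only [List.mem_singleton] at hb
        rintro rfl
        exact ho (hb ▸ ha)
    · intro l _ l' _ h
      simpa using h
  · have : ∑ k ∈ Finset.HasAntidiagonal.antidiagonal n, sawCount G o k.1 * sawCount G o k.2 =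
        ((Finset.HasAntidiagonal.antidiagonal n).sigma fun k => sawFinset hfin o k.1 ×ˢ sawFinset hfin o k.2).card := by
      rw [Finset.card_sigma]
      refine Finset.sum_congr rfl fun k _ => ?_
      rw [Finset.card_product, card_sawFinset, card_sawFinset]
    rw [this]
    refine Finset.card_le_card_of_injOn (fun l => ⟨(l.idxOf o, (l.drop (l.idxOf o + 1)).length),
      (l.take (l.idxOf o + 1), (l.drop (l.idxOf o)).reverse)⟩) ?_ ?_
    · intro l hl
      rw [Finset.mem_coe, Finset.mem_filter, mem_sawFinset, not_not] at hl
      obtain ⟨hl, ho⟩ := hl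
      have hn : l.idxOf o < l.length := List.idxOf_lt_length_iff.2 ho
      have hget : l[l.idxOf o] = o := List.getElem_idxOf hn
      set k := l.idxOf o with hk
      have hl' : l.take k ++ o :: l.drop (k + 1) = l := by
        conv_lhs => rw [← hget]
        rw [List.getElem_cons_drop, List.take_append_drop]
      have hlen : (l.take k).length = k := by simp; omega
      rw [← hl'] at hl
      obtain ⟨h1, h2, h3⟩ := append_cons_mem_saws hl
      rw [hlen] at h1 h3
      simp only [Finset.coe_sigma, Set.mem_sigma_iff, Finset.mem_coe, mem_sawFinset,
        Finset.HasAntidiagonal.mem_antidiagonal, Finset.mem_product]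
      refine ⟨h3, ?_, ?_⟩
      · rw [List.take_succ_eq_append_getElem hn, hget]
        exact h1
      · rw [← List.getElem_cons_drop hn, hget]
        exact reverse_mem_saws h2
    · intro l hl l' hl' h
      simp only [Sigma.mk.injEq, Prod.mk.injEq, heq_eq_eq, List.reverse_inj] at h
      obtain ⟨⟨h1, -⟩, h2, h3⟩ := h
      rw [← List.take_append_drop (l.idxOf o) l, ← List.take_append_drop (l'.idxOf o) l', h3]
      rw [← h1] at h2
      have := congrArg (List.take (l.idxOf o)) h2
      rw [← h1, show List.take (l.idxOf o) l = List.take (l.idxOf o) l' by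
        simpa [List.take_take] using this]

theorem sawCount_iso {W' : Type v} {G' : SimpleGraph W'} (φ : G ≃g G') (o : W) (n : ℕ) :
    sawCount G' (φ o) n = sawCount G o n := by
  rw [sawCount_eq_ncard, sawCount_eq_ncard]
  symm
  refine Set.ncard_congr (fun l _ => l.map φ) ?_ ?_ ?_
  · rintro l ⟨hc, hnd, hlen, hlast⟩
    refine ⟨?_, hnd.map φ.injective, by simpa using hlen, by simp [hlast]⟩
    rw [List.isChain_map]
    exact hc.imp fun a b h => φ.map_adj_iff.2 h
  · intro a b _ _ h
    exact List.map_injective_iff.2 φ.injective h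
  · rintro l ⟨hc, hnd, hlen, hlast⟩
    refine ⟨l.map φ.symm, ⟨?_, hnd.map φ.symm.injective, by simpa using hlen, by simp [hlast]⟩, ?_⟩
    · rw [List.isChain_map]
      exact hc.imp fun a b h => φ.symm.map_adj_iff.2 h
    · simp [List.map_map, Function.comp_def]

theorem sawCount_eq_zero_of_le (hfin : ∀ x, (G.neighborSet x).Finite) {o : W} {m n : ℕ}
    (hmn : m ≤ n) (h : sawCount G o m = 0) : sawCount G o n = 0 := by
  induction n, hmn using Nat.le_induction with
  | base => exact h
  | succ n _ ih =>
    rw [sawCount_eq_ncard, Set.ncard_eq_zero (finite_saws hfin _ _)] at ih ⊢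
    refine Set.eq_empty_of_forall_notMem fun l hl => ?_
    obtain ⟨x, y, t, rfl⟩ := exists_eq_cons_cons_of_mem_saws hl
    exact Set.notMem_empty _ (ih ▸ (cons_mem_saws.1 hl).2.2)

end Lists


/-! ### Power series with nonnegative coefficients, and the renewal theorem. -/

section Series

open PowerSeries

/-- The real power series `F` converges absolutely at `z ≥ 0`. -/
def SummableAt (F : PowerSeries ℝ) (z : ℝ) : Prop :=
  Summable fun n => coeff n F * z ^ n

/-- The sum of the real power series `F` at `z`. -/
noncomputable def evalAt (F : PowerSeries ℝ) (z : ℝ) : ℝ :=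
  ∑' n, coeff n F * z ^ n

theorem SummableAt.mono {F : PowerSeries ℝ} (hF : ∀ n, 0 ≤ coeff n F) {z w : ℝ} (hz : 0 ≤ z)
    (hzw : z ≤ w) (h : SummableAt F w) : SummableAt F z :=
  Summable.of_nonneg_of_le (fun n => mul_nonneg (hF n) (pow_nonneg hz n))
    (fun n => mul_le_mul_of_nonneg_left (pow_le_pow_left₀ hz hzw n) (hF n)) h

theorem evalAt_mono {F : PowerSeries ℝ} (hF : ∀ n, 0 ≤ coeff n F) {z w : ℝ} (hz : 0 ≤ z)
    (hzw : z ≤ w) (h : SummableAt F w) : evalAt F z ≤ evalAt F w :=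
  (h.mono hF hz hzw).tsum_le_tsum
    (fun n => mul_le_mul_of_nonneg_left (pow_le_pow_left₀ hz hzw n) (hF n)) h

theorem evalAt_nonneg {F : PowerSeries ℝ} (hF : ∀ n, 0 ≤ coeff n F) {z : ℝ} (hz : 0 ≤ z) :
    0 ≤ evalAt F z :=
  tsum_nonneg fun n => mul_nonneg (hF n) (pow_nonneg hz n)

theorem continuousOn_evalAt {F : PowerSeries ℝ} (hF : ∀ n, 0 ≤ coeff n F) {w : ℝ}
    (h : SummableAt F w) : ContinuousOn (evalAt F) (Set.Icc 0 w) := by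
  refine continuousOn_tsum (u := fun n => coeff n F * w ^ n) (fun n => by fun_prop) h ?_
  rintro n z ⟨hz, hzw⟩
  rw [Real.norm_of_nonneg (mul_nonneg (hF n) (pow_nonneg hz n))]
  exact mul_le_mul_of_nonneg_left (pow_le_pow_left₀ hz hzw n) (hF n)

theorem coeff_mul_nonneg {F H : PowerSeries ℝ} (hF : ∀ n, 0 ≤ coeff n F)
    (hH : ∀ n, 0 ≤ coeff n H) (n : ℕ) : 0 ≤ coeff n (F * H) := by
  rw [coeff_mul]
  exact Finset.sum_nonneg fun p _ => mul_nonneg (hF _) (hH _)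

theorem coeff_mul_mul_pow (F H : PowerSeries ℝ) (z : ℝ) (n : ℕ) :
    coeff n (F * H) * z ^ n = ∑ p ∈ Finset.HasAntidiagonal.antidiagonal n,
      (coeff p.1 F * z ^ p.1) * (coeff p.2 H * z ^ p.2) := by
  rw [coeff_mul, Finset.sum_mul]
  refine Finset.sum_congr rfl fun p hp => ?_
  rw [← Finset.HasAntidiagonal.mem_antidiagonal.1 hp, pow_add]
  ring

theorem evalAt_mul {F H : PowerSeries ℝ} {z : ℝ} (h1 : SummableAt F z) (h2 : SummableAt H z) :
    SummableAt (F * H) z ∧ evalAt (F * H) z = evalAt F z * evalAt H z := by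
  have h1' : Summable fun n => ‖coeff n F * z ^ n‖ := h1.norm
  have h2' : Summable fun n => ‖coeff n H * z ^ n‖ := h2.norm
  constructor
  · have := (summable_norm_sum_mul_antidiagonal_of_summable_norm h1' h2').of_norm
    exact this.congr fun n => (coeff_mul_mul_pow F H z n).symm
  · rw [evalAt, evalAt, evalAt, tsum_mul_tsum_eq_tsum_sum_antidiagonal_of_summable_norm h1' h2']
    exact tsum_congr fun n => coeff_mul_mul_pow F H z n

theorem summableAt_one (z : ℝ) : SummableAt 1 z := by
  refine summable_of_ne_finset_zero (s := {0}) fun n hn => ?_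
  rw [coeff_one, if_neg (by simpa using hn), zero_mul]

theorem evalAt_one (z : ℝ) : evalAt 1 z = 1 := by
  rw [evalAt, tsum_eq_single 0]
  · simp
  · intro n hn
    rw [coeff_one, if_neg hn, zero_mul]

theorem evalAt_one_add {F : PowerSeries ℝ} {z : ℝ} (h : SummableAt F z) :
    SummableAt (1 + F) z ∧ evalAt (1 + F) z = 1 + evalAt F z := by
  have h1 := summableAt_one z
  constructor
  · refine (h1.add h).congr fun n => ?_
    rw [map_add, add_mul]
  · rw [← evalAt_one z, evalAt, evalAt, evalAt, ← Summable.tsum_add h1 h]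
    refine tsum_congr fun n => ?_
    rw [map_add, add_mul]

theorem coeff_one_add_nonneg {F : PowerSeries ℝ} (hF : ∀ n, 0 ≤ coeff n F) (n : ℕ) :
    0 ≤ coeff n (1 + F) := by
  rw [map_add, coeff_one]
  have := hF n
  split_ifs <;> linarith

/-- A power series with nonnegative coefficients, without constant term and with a linear term,
whose sum is unbounded on its domain of convergence in `(0, ∞)`. -/
structure Supercritical (F : PowerSeries ℝ) : Prop where
  nonneg : ∀ n, 0 ≤ coeff n F
  coeff_zero : coeff 0 F = 0
  coeff_one_pos : 0 < coeff 1 F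
  unbounded : ∀ K : ℝ, ∃ z, 0 < z ∧ SummableAt F z ∧ K < evalAt F z

theorem Supercritical.evalAt_pos {F : PowerSeries ℝ} (hF : Supercritical F) {z : ℝ} (hz : 0 < z)
    (h : SummableAt F z) : 0 < evalAt F z :=
  h.tsum_pos (fun n => mul_nonneg (hF.nonneg n) (pow_nonneg hz.le n)) 1
    (mul_pos hF.coeff_one_pos (pow_pos hz 1))

/-- Beyond a fixed `z₀` the value of `b` stays at least `evalAt b z₀ > 0`, while `a` grows without
bound. Asking for more than `evalAt a z₀` forces `z` beyond `z₀`. -/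
theorem Supercritical.exists_one_lt_mul {a b : PowerSeries ℝ} (ha : Supercritical a)
    (hb : Supercritical b) (hab : ∀ z, 0 < z → SummableAt a z → SummableAt b z) :
    ∃ z, 0 < z ∧ SummableAt a z ∧ SummableAt b z ∧ 1 < evalAt a z * evalAt b z := by
  obtain ⟨z₀, hz₀, hs₀, -⟩ := ha.unbounded 0
  have hbpos := hb.evalAt_pos hz₀ (hab z₀ hz₀ hs₀)
  obtain ⟨z, hz, hs, hK⟩ := ha.unbounded (max (1 / evalAt b z₀) (evalAt a z₀))
  have h1 := (le_max_left _ _).trans_lt hK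
  have h2 := (le_max_right _ _).trans_lt hK
  have hzz : z₀ ≤ z := by
    by_contra! hlt
    exact absurd (evalAt_mono ha.nonneg hz.le hlt.le hs₀) (not_le.2 h2)
  refine ⟨z, hz, hs, hab z hz hs, ?_⟩
  have h3 := evalAt_mono hb.nonneg hz₀.le hzz (hab z hz hs)
  calc 1 = 1 / evalAt b z₀ * evalAt b z₀ := by field_simp
    _ < evalAt a z * evalAt b z₀ := by gcongr
    _ ≤ evalAt a z * evalAt b z := by
      gcongr
      exact evalAt_nonneg ha.nonneg hz.le

/-- The series with the smaller domain of convergence plays the role of `a` in the preceding lemma;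
the rest is the intermediate value theorem. The gap `ρ < w` is what later yields exponential tails.
-/
theorem Supercritical.exists_mul_eq_one {a b : PowerSeries ℝ} (ha : Supercritical a)
    (hb : Supercritical b) : ∃ ρ w, 0 < ρ ∧ ρ < w ∧ SummableAt a w ∧ SummableAt b w ∧
      evalAt a ρ * evalAt b ρ = 1 := by
  have key : ∃ z, 0 < z ∧ SummableAt a z ∧ SummableAt b z ∧ 1 < evalAt a z * evalAt b z := by
    by_cases h : ∀ z, 0 < z → SummableAt a z → SummableAt b z
    · exact ha.exists_one_lt_mul hb h
    · push Not at h
      obtain ⟨w, hw, haw, hbw⟩ := h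
      obtain ⟨z, hz, h1, h2, h3⟩ := hb.exists_one_lt_mul ha fun z hz hs => by
        refine haw.mono ha.nonneg hz.le ?_
        by_contra! hlt
        exact hbw (hs.mono hb.nonneg hw.le hlt.le)
      exact ⟨z, hz, h2, h1, by rwa [mul_comm]⟩
  obtain ⟨w, hw, haw, hbw, h1⟩ := key
  have hcont : ContinuousOn (fun z => evalAt a z * evalAt b z) (Set.Icc 0 w) :=
    (continuousOn_evalAt ha.nonneg haw).mul (continuousOn_evalAt hb.nonneg hbw)
  have h0 : evalAt a 0 = 0 := by
    rw [evalAt, tsum_eq_single 0]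
    · simp [ha.coeff_zero]
    · intro n hn
      simp [hn]
  have hmem : (1 : ℝ) ∈ Set.Ioo (evalAt a 0 * evalAt b 0) (evalAt a w * evalAt b w) := by
    rw [h0, zero_mul]
    exact ⟨one_pos, h1⟩
  obtain ⟨ρ, ⟨hρ0, hρw⟩, hρ⟩ := intermediate_value_Ioo hw.le hcont hmem
  exact ⟨ρ, w, hρ0, hρw, haw, hbw, hρ⟩

/-! ### Renewal sequences -/

theorem renewal_nonneg {F U : PowerSeries ℝ} (hF : ∀ n, 0 ≤ coeff n F) (hF0 : coeff 0 F = 0)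
    (hU : U * (1 - F) = 1) (n : ℕ) : 0 ≤ coeff n U := by
  have hU' : U = 1 + F * U := by linear_combination hU
  induction n using Nat.strong_induction_on with
  | _ n ih =>
    rw [hU', map_add, coeff_mul]
    refine add_nonneg (by rw [coeff_one]; split_ifs <;> simp) (Finset.sum_nonneg fun p hp => ?_)
    rcases Nat.eq_zero_or_pos p.1 with h | h
    · rw [h, hF0, zero_mul]
    · have := Finset.HasAntidiagonal.mem_antidiagonal.1 hp
      exact mul_nonneg (hF _) (ih _ (by omega))

/-- The generating series of the tails of the distribution `F`. -/
noncomputable def tailSeries (F : PowerSeries ℝ) : PowerSeries ℝ :=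
  (1 - F) * mk 1

theorem tailSeries_mul (F : PowerSeries ℝ) : tailSeries F * (1 - X) = 1 - F := by
  rw [tailSeries, mul_assoc, mk_one_mul_one_sub_eq_one, mul_one]

theorem coeff_tailSeries (F : PowerSeries ℝ) (n : ℕ) :
    coeff n (tailSeries F) = 1 - ∑ k ∈ Finset.range (n + 1), coeff k F := by
  rw [tailSeries, sub_mul, one_mul, map_sub, coeff_mul, coeff_mk,
    Finset.Nat.sum_antidiagonal_eq_sum_range_succ_mk]
  simp

theorem coeff_tailSeries_nonneg {F : PowerSeries ℝ} (hF : ∀ n, 0 ≤ coeff n F)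
    (hF1 : HasSum (fun n => coeff n F) 1) (n : ℕ) : 0 ≤ coeff n (tailSeries F) := by
  rw [coeff_tailSeries, sub_nonneg]
  exact sum_le_hasSum _ (fun n _ => hF n) hF1

/-- At each time `n` exactly one renewal epoch is the last one so far, so the probabilities `U_k
T_{n-k}` add up to 1. -/
theorem mul_tailSeries {F U : PowerSeries ℝ} (hU : U * (1 - F) = 1) :
    tailSeries F * U = mk 1 := by
  have h1 := tailSeries_mul F
  have h2 := mk_one_mul_one_sub_eq_one ℝ
  calc tailSeries F * U = tailSeries F * U * (mk 1 * (1 - X)) := by rw [h2, mul_one]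
    _ = (tailSeries F * (1 - X)) * U * mk 1 := by ring
    _ = (U * (1 - F)) * mk 1 := by rw [h1]; ring
    _ = mk 1 := by rw [hU, one_mul]

/-- `U_n` is one of the nonnegative terms of the convolution in `mul_tailSeries`, because `T_0 = 1`.
-/
theorem renewal_le_one {F U : PowerSeries ℝ} (hF : ∀ n, 0 ≤ coeff n F) (hF0 : coeff 0 F = 0)
    (hF1 : HasSum (fun n => coeff n F) 1) (hU : U * (1 - F) = 1) (n : ℕ) : coeff n U ≤ 1 := by
  have h := congrArg (coeff n) (mul_tailSeries hU)
  rw [coeff_mul, coeff_mk] at h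
  have h0 : coeff 0 (tailSeries F) = 1 := by rw [coeff_tailSeries]; simp [hF0]
  have hle := Finset.single_le_sum
    (f := fun p : ℕ × ℕ => coeff p.1 (tailSeries F) * coeff p.2 U)
    (fun p _ => mul_nonneg (coeff_tailSeries_nonneg hF hF1 p.1) (renewal_nonneg hF hF0 hU p.2))
    (show (0, n) ∈ Finset.HasAntidiagonal.antidiagonal n by simp)
  simp only [h0, one_mul] at hle
  rw [h] at hle
  simpa using hle

/-- The tail beyond `n` is at most `F(r) r⁻ⁿ`. Summability of the tails means that the mean is
finite. -/
theorem summable_tailSeries {F : PowerSeries ℝ} (hF : ∀ n, 0 ≤ coeff n F)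
    (hF1 : HasSum (fun n => coeff n F) 1) {r : ℝ} (hr : 1 < r) (hs : SummableAt F r) :
    Summable fun n => coeff n (tailSeries F) := by
  have hr0 : 0 < r := one_pos.trans hr
  have hgeo : Summable fun n : ℕ => evalAt F r * (r⁻¹) ^ n :=
    (summable_geometric_of_lt_one (inv_nonneg.2 hr0.le) (inv_lt_one_of_one_lt₀ hr)).mul_left _
  refine Summable.of_nonneg_of_le (coeff_tailSeries_nonneg hF hF1) (fun n => ?_) hgeo
  rw [coeff_tailSeries, inv_pow, ← div_eq_mul_inv, le_div_iff₀ (pow_pos hr0 n)]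
  have hsplit := hF1.summable.sum_add_tsum_nat_add (n + 1)
  rw [hF1.tsum_eq] at hsplit
  have h1 : 1 - ∑ k ∈ Finset.range (n + 1), coeff k F = ∑' k, coeff (k + (n + 1)) F := by
    linarith
  rw [h1, ← tsum_mul_right, evalAt]
  have hs' : Summable fun k => coeff (k + (n + 1)) F * r ^ (k + (n + 1)) :=
    (summable_nat_add_iff (f := fun k => coeff k F * r ^ k) (n + 1)).2 hs
  have hs'' : Summable fun k => coeff (k + (n + 1)) F * r ^ n :=
    ((summable_nat_add_iff (f := fun k => coeff k F) (n + 1)).2 hF1.summable).mul_right _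
  refine (hs''.tsum_le_tsum (fun k => ?_) hs').trans ?_
  · exact mul_le_mul_of_nonneg_left (pow_le_pow_right₀ hr.le (by omega)) (hF _)
  · have := Summable.sum_add_tsum_nat_add (f := fun k => coeff k F * r ^ k) (n + 1) hs
    have hnn : 0 ≤ ∑ k ∈ Finset.range (n + 1), coeff k F * r ^ k :=
      Finset.sum_nonneg fun k _ => mul_nonneg (hF k) (pow_nonneg hr0.le k)
    linarith

/-- Passing to the limit in a convolution with a summable series along a filter. -/
theorem tendsto_coeff_mul {H U : PowerSeries ℝ} (hH : ∀ n, 0 ≤ coeff n H)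
    (hHs : Summable fun n => coeff n H) (hU0 : ∀ n, 0 ≤ coeff n U) (hU1 : ∀ n, coeff n U ≤ 1)
    {l : Filter ℕ} (hl : l ≤ atTop) {L : ℕ → ℝ} (j : ℕ)
    (hL : ∀ k, Tendsto (fun n => coeff (n - k) U) l (𝓝 (L k))) :
    Tendsto (fun n => coeff (n - j) (H * U)) l (𝓝 (∑' k, coeff k H * L (j + k))) := by
  have heq : ∀ n, coeff (n - j) (H * U) =
      ∑' k, if k ≤ n - j then coeff k H * coeff (n - j - k) U else 0 := by
    intro n
    rw [coeff_mul, Finset.Nat.sum_antidiagonal_eq_sum_range_succ_mk,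
      tsum_eq_sum (s := Finset.range (n - j + 1))]
    · refine Finset.sum_congr rfl fun k hk => ?_
      rw [if_pos (by simpa [Nat.lt_succ_iff] using hk)]
    · intro k hk
      rw [if_neg (by simpa [Nat.lt_succ_iff] using hk)]
  simp only [heq]
  refine tendsto_tsum_of_dominated_convergence hHs (fun k => ?_) (Eventually.of_forall fun n k => ?_)
  · refine ((hL (j + k)).const_mul (coeff k H)).congr' ?_
    filter_upwards [hl (eventually_ge_atTop (j + k))] with n hn
    rw [if_pos (by omega), Nat.sub_sub]
  · split_ifs
    · rw [Real.norm_of_nonneg (mul_nonneg (hH _) (hU0 _))]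
      exact mul_le_of_le_one_right (hH _) (hU1 _)
    · simpa using hH k

/-- The renewal theorem for a distribution on the positive integers with finite mean which charges
`2` and `3`. -/
theorem renewal_tendsto {F U : PowerSeries ℝ} (hF : ∀ n, 0 ≤ coeff n F) (hF0 : coeff 0 F = 0)
    (hF1 : HasSum (fun n => coeff n F) 1) (hU : U * (1 - F) = 1)
    (hT : Summable fun n => coeff n (tailSeries F)) (h2 : 0 < coeff 2 F) (h3 : 0 < coeff 3 F) :
    ∃ A : ℝ, 0 < A ∧ Tendsto (fun n => coeff n U) atTop (𝓝 A) := by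
  have hU0 := renewal_nonneg hF hF0 hU
  have hU1 := renewal_le_one hF hF0 hF1 hU
  have hU' : U = 1 + F * U := by linear_combination hU
  have hTn := coeff_tailSeries_nonneg hF hF1
  set τ := ∑' n, coeff n (tailSeries F) with hτ
  have hτpos : 0 < τ := by
    refine hT.tsum_pos hTn 0 ?_
    rw [coeff_tailSeries]
    simp [hF0]
  have hmemIcc : ∀ n, coeff n U ∈ Set.Icc (0 : ℝ) 1 := fun n => ⟨hU0 n, hU1 n⟩
  -- Maximum principle for cluster points: `s = 1` serves the greatest one and `s = -1` the least.
  have extremal : ∀ (s : ℝ) (x : ℝ), MapClusterPt x atTop (fun n => coeff n U) →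
      (∀ y, MapClusterPt y atTop (fun n => coeff n U) → 0 ≤ s * (x - y)) → s ≠ 0 →
      x = τ⁻¹ := by
    intro s x hx hext hs
    -- Along an ultrafilter all shifted sequences converge at once, to limits `L j`.
    obtain ⟨l, hl, hlx⟩ := mapClusterPt_iff_ultrafilter.1 hx
    have hex : ∀ j, ∃ y, Tendsto (fun n => coeff (n - j) U) l (𝓝 y) := by
      intro j
      obtain ⟨y, -, hy⟩ := (isCompact_Icc (a := (0 : ℝ)) (b := 1)).ultrafilter_le_nhds
        (l.map fun n => coeff (n - j) U) (by
          rw [le_principal_iff]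
          exact Eventually.of_forall (f := (l : Filter ℕ)) fun n => hmemIcc (n - j))
      exact ⟨y, hy⟩
    choose L hL using hex
    have hcl : ∀ j, MapClusterPt (L j) atTop (fun n => coeff n U) := by
      intro j
      have hmap : Tendsto (fun n => n - j) (l : Filter ℕ) atTop :=
        (tendsto_sub_atTop_nat j).mono_left hl
      have : MapClusterPt (L j) l ((fun n => coeff n U) ∘ fun n => n - j) := (hL j).mapClusterPt
      exact this.of_comp hmap
    have hL0 : L 0 = x := tendsto_nhds_unique (hL 0) (by simpa using hlx)
    have hrec : ∀ j, L j = ∑' k, coeff k F * L (j + k) := by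
      intro j
      refine tendsto_nhds_unique (hL j) ?_
      refine (tendsto_coeff_mul hF hF1.summable hU0 hU1 hl j hL).congr' ?_
      filter_upwards [hl (eventually_gt_atTop j)] with n hn
      conv_rhs => rw [hU', map_add, coeff_one, if_neg (by omega), zero_add]
    have hsumm : ∀ j, Summable fun k => coeff k F * L (j + k) := by
      intro j
      refine Summable.of_nonneg_of_le (fun k => mul_nonneg (hF k) ?_) (fun k => ?_) hF1.summable
      · exact ge_of_tendsto' (hL _) fun n => hU0 _
      · exact mul_le_of_le_one_right (hF k) (le_of_tendsto' (hL _) fun n => hU1 _)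
    -- `L j` is the `F`-average of the `L (j + k)`. If it is extremal, every value with positive
    -- weight equals it.
    have hstep : ∀ j, L j = x → ∀ k, 0 < coeff k F → L (j + k) = x := by
      intro j hj k hk
      have hs1 : HasSum (fun k => coeff k F * (s * (x - L (j + k)))) (s * (x * 1 - L j)) := by
        have := ((hF1.mul_left x).sub (hrec j ▸ (hsumm j).hasSum)).mul_left s
        exact this.congr_fun fun k => by ring
      rw [hj, mul_one, sub_self, mul_zero] at hs1
      have hz := (hasSum_zero_iff_of_nonneg
        (fun k => mul_nonneg (hF k) (hext _ (hcl (j + k))))).1 hs1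
      have := congrFun hz k
      simp only [Pi.zero_apply, mul_eq_zero, hk.ne', hs, false_or] at this
      linarith
    -- Steps 2 and 3 reach every integer from 2 on, so `L` is constant there.
    have hall : ∀ k, L (2 + k) = x := by
      intro k
      induction k using Nat.strong_induction_on with
      | _ k ih =>
        match k, ih with
        | 0, _ => simpa using hstep 0 hL0 2 h2
        | 1, _ => simpa using hstep 0 hL0 3 h3
        | k + 2, ih => exact hstep (2 + k) (ih k (by omega)) 2 h2
    -- Passing to the limit in `T * U = 1 / (1 - X)`, shifted by 2 so that only known values of `L`
    -- enter, gives `τ * x = 1`.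
    have hone := tendsto_coeff_mul hTn hT hU0 hU1 hl 2 hL
    rw [mul_tailSeries hU] at hone
    simp only [coeff_mk, hall, Pi.one_apply, tsum_mul_right] at hone
    have := tendsto_nhds_unique hone tendsto_const_nhds
    exact eq_inv_of_mul_eq_one_right this
  have hclosed : IsClosed {x | MapClusterPt x atTop (fun n => coeff n U)} :=
    isClosed_setOfPred_clusterPt
  have hsub : {x | MapClusterPt x atTop (fun n => coeff n U)} ⊆ Set.Icc 0 1 := by
    intro x hx
    exact isClosed_Icc.mem_of_mapClusterPt hx (Eventually.of_forall hmemIcc)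
  have hcompact := isCompact_Icc.of_isClosed_subset hclosed hsub
  have hne : {x | MapClusterPt x atTop (fun n => coeff n U)}.Nonempty := by
    obtain ⟨x, -, hx⟩ := (isCompact_Icc (a := (0 : ℝ)) (b := 1)).exists_mapClusterPt
      (f := atTop) (u := fun n => coeff n U) (by
        rw [map_le_iff_le_comap]
        simp [hmemIcc])
    exact ⟨x, hx⟩
  obtain ⟨x, hx, hxmax⟩ := hcompact.exists_isGreatest hne
  obtain ⟨y, hy, hymin⟩ := hcompact.exists_isLeast hne
  have hx' := extremal 1 x hx (fun z hz => by linarith [hxmax hz]) one_ne_zero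
  have hy' := extremal (-1) y hy (fun z hz => by linarith [hymin hz]) (by norm_num)
  refine ⟨τ⁻¹, inv_pos.2 hτpos, ?_⟩
  refine (isCompact_Icc (a := (0 : ℝ)) (b := 1)).tendsto_nhds_of_unique_mapClusterPt
    (Eventually.of_forall hmemIcc) ?_
  intro z _ hz
  exact le_antisymm (hx' ▸ hxmax hz) (hy' ▸ hymin hz)

end Series


/-! ### Combining two supercritical series. -/

section Combine

open PowerSeries

theorem coeff_mul_pos {F H : PowerSeries ℝ} (hF : ∀ n, 0 ≤ coeff n F)
    (hH : ∀ n, 0 ≤ coeff n H) {i j n : ℕ} (hn : i + j = n) (hi : 0 < coeff i F)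
    (hj : 0 < coeff j H) : 0 < coeff n (F * H) := by
  subst hn
  rw [coeff_mul]
  refine (mul_pos hi hj).trans_le ?_
  exact Finset.single_le_sum (f := fun p : ℕ × ℕ => coeff p.1 F * coeff p.2 H)
    (fun p _ => mul_nonneg (hF _) (hH _))
    (show (i, j) ∈ Finset.HasAntidiagonal.antidiagonal (i + j) by simp)

theorem Supercritical.constantCoeff_eq_zero {a : PowerSeries ℝ} (ha : Supercritical a) :
    constantCoeff a = 0 := by
  simpa using ha.coeff_zero

theorem coeff_rescale_nonneg {F : PowerSeries ℝ} (hF : ∀ n, 0 ≤ coeff n F) {ρ : ℝ} (hρ : 0 < ρ)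
    (n : ℕ) : 0 ≤ coeff n (rescale ρ F) := by
  rw [coeff_rescale]
  exact mul_nonneg (pow_nonneg hρ.le n) (hF n)

theorem hasSum_coeff_rescale {F : PowerSeries ℝ} {ρ : ℝ} (h : SummableAt F ρ) :
    HasSum (fun n => coeff n (rescale ρ F)) (evalAt F ρ) := by
  refine (Summable.hasSum h).congr_fun fun n => ?_
  rw [coeff_rescale, mul_comm]

theorem rescale_renewal {F U : PowerSeries ℝ} (hU : U * (1 - F) = 1) (ρ : ℝ) :
    rescale ρ U * (1 - rescale ρ F) = 1 := by
  rw [← map_one (rescale ρ), ← map_sub, ← map_mul, hU, map_one]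

/-- After rescaling by `ρ` the renewal coefficients are at most 1, so comparison with the geometric
series of ratio `z / ρ` applies. -/
theorem summableAt_renewal {F U : PowerSeries ℝ} (hF : ∀ n, 0 ≤ coeff n F) (hF0 : coeff 0 F = 0)
    (hU : U * (1 - F) = 1) {ρ : ℝ} (hρ : 0 < ρ) (hs : SummableAt F ρ) (h1 : evalAt F ρ = 1)
    {z : ℝ} (hz : 0 < z) (hzρ : z < ρ) : SummableAt U z := by
  have hUn := renewal_nonneg hF hF0 hU
  have hUle := renewal_le_one (coeff_rescale_nonneg hF hρ)
    (by rw [coeff_rescale, hF0, mul_zero]) (h1 ▸ hasSum_coeff_rescale hs) (rescale_renewal hU ρ)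
  refine Summable.of_nonneg_of_le (fun n => mul_nonneg (hUn n) (pow_nonneg hz.le n)) (fun n => ?_)
    (summable_geometric_of_lt_one (div_nonneg hz.le hρ.le) ((div_lt_one hρ).2 hzρ))
  have := hUle n
  rw [coeff_rescale] at this
  rw [div_pow, le_div_iff₀ (pow_pos hρ n)]
  calc coeff n U * z ^ n * ρ ^ n = ρ ^ n * coeff n U * z ^ n := by ring
    _ ≤ 1 * z ^ n := by gcongr
    _ = z ^ n := one_mul _

/-- A renewal series is unbounded near the point where the distribution becomes proper. -/
theorem exists_lt_evalAt_renewal {F U : PowerSeries ℝ} (hF : ∀ n, 0 ≤ coeff n F)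
    (hF0 : coeff 0 F = 0) (hU : U * (1 - F) = 1) {ρ w : ℝ} (hρ : 0 < ρ) (hρw : ρ < w)
    (hs : SummableAt F w) (h1 : evalAt F ρ = 1) {K : ℝ} (hK : 0 < K) :
    ∃ z, 0 < z ∧ z < ρ ∧ SummableAt U z ∧ K ≤ evalAt U z := by
  have hU' : U = 1 + F * U := by linear_combination hU
  have hcont : ContinuousAt (evalAt F) ρ :=
    (continuousOn_evalAt hF hs).continuousAt (Icc_mem_nhds hρ hρw)
  have hev : ∀ᶠ z in 𝓝[<] ρ, 1 - 1 / K < evalAt F z := by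
    refine (hcont.tendsto.eventually (lt_mem_nhds ?_)).filter_mono nhdsWithin_le_nhds
    rw [h1]
    have : 0 < 1 / K := by positivity
    linarith
  obtain ⟨z, hz1, hz0, hzρ⟩ := (hev.and (Ioo_mem_nhdsLT hρ)).exists
  have hUs := summableAt_renewal hF hF0 hU hρ (hs.mono hF hρ.le hρw.le) h1 hz0 hzρ
  obtain ⟨hFUs, hFU⟩ := evalAt_mul (hs.mono hF hz0.le (hzρ.trans hρw).le) hUs
  have hUval : evalAt U z = 1 + evalAt F z * evalAt U z := by
    have := (evalAt_one_add hFUs).2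
    rwa [← hU', hFU] at this
  refine ⟨z, hz0, hzρ, hUs, ?_⟩
  -- `U(z)` is the inverse of `1 - F(z)`, and `z` was chosen with `1 - F(z) < 1 / K`.
  have h3 : evalAt U z * (1 - evalAt F z) = 1 := by linear_combination hUval
  have h4 : 1 - evalAt F z ≤ 1 / K := by linarith
  have h5 : 1 ≤ evalAt U z * (1 / K) :=
    h3.symm.le.trans (mul_le_mul_of_nonneg_left h4
      (evalAt_nonneg (renewal_nonneg hF hF0 hU) hz0.le))
  rwa [mul_one_div, le_div_iff₀ hK, one_mul] at h5

theorem evalAt_one_add_mul {a b : PowerSeries ℝ} (ha : ∀ n, 0 ≤ coeff n a)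
    (hb : ∀ n, 0 ≤ coeff n b) {z : ℝ} (hz : 0 ≤ z) (has : SummableAt a z) (hbs : SummableAt b z) :
    SummableAt ((1 + a) * (1 + b)) z ∧ 1 ≤ evalAt ((1 + a) * (1 + b)) z := by
  obtain ⟨h1as, h1ae⟩ := evalAt_one_add has
  obtain ⟨h1bs, h1be⟩ := evalAt_one_add hbs
  obtain ⟨hHs, hHe⟩ := evalAt_mul h1as h1bs
  refine ⟨hHs, ?_⟩
  rw [hHe, h1ae, h1be]
  have := evalAt_nonneg ha hz
  have := evalAt_nonneg hb hz
  nlinarith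

theorem Supercritical.exists_renewal {a b N : PowerSeries ℝ} (ha : Supercritical a)
    (hN : N * (1 - a * b) = (1 + a) * (1 + b)) :
    ∃ U, U * (1 - a * b) = 1 ∧ N = (1 + a) * (1 + b) * U := by
  have hU : (1 - a * b)⁻¹ * (1 - a * b) = 1 :=
    PowerSeries.inv_mul_cancel _ (by simp [ha.constantCoeff_eq_zero])
  refine ⟨_, hU, ?_⟩
  rw [← hN, mul_assoc, mul_comm (1 - a * b), hU, mul_one]

/-- The renewal series attached to two supercritical series is again supercritical. -/
theorem Supercritical.combine {a b N : PowerSeries ℝ} (ha : Supercritical a)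
    (hb : Supercritical b) (hN : N * (1 - a * b) = (1 + a) * (1 + b)) :
    Supercritical (N - 1) ∧ 0 < coeff 2 (N - 1) := by
  obtain ⟨ρ, w, hρ, hρw, haw, hbw, hab⟩ := ha.exists_mul_eq_one hb
  have hfn : ∀ n, 0 ≤ coeff n (a * b) := coeff_mul_nonneg ha.nonneg hb.nonneg
  have ha0 := ha.constantCoeff_eq_zero
  have hb0 := hb.constantCoeff_eq_zero
  have hf0 : coeff 0 (a * b) = 0 := by simp [ha0]
  obtain ⟨hfw, -⟩ := evalAt_mul haw hbw
  have hfρ1 : evalAt (a * b) ρ = 1 := by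
    rw [← hab]
    exact (evalAt_mul (haw.mono ha.nonneg hρ.le hρw.le) (hbw.mono hb.nonneg hρ.le hρw.le)).2
  obtain ⟨U, hU, hNU⟩ := ha.exists_renewal hN
  have hUn := renewal_nonneg hfn hf0 hU
  have hHn := coeff_mul_nonneg (coeff_one_add_nonneg ha.nonneg) (coeff_one_add_nonneg hb.nonneg)
  -- Unfolding `U = 1 + a b U` once exhibits `N - 1` as a sum of series with nonnegative
  -- coefficients. The coefficients 1 and 2 are then bounded below by those of `a`, `b` and `a * b`.
  have hN1 : N - 1 = a + b + a * b + (1 + a) * (1 + b) * (a * b * U) := by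
    linear_combination hNU + (1 + a) * (1 + b) * hU
  have hRn := coeff_mul_nonneg hHn (coeff_mul_nonneg hfn hUn)
  have hc : ∀ n, coeff n (N - 1) = coeff n a + coeff n b + coeff n (a * b) +
      coeff n ((1 + a) * (1 + b) * (a * b * U)) := by
    intro n
    rw [hN1, map_add, map_add, map_add]
  have hcn : ∀ n, 0 ≤ coeff n (N - 1) := by
    intro n
    rw [hc]
    have := ha.nonneg n
    have := hb.nonneg n
    have := hfn n
    have := hRn n
    linarith
  refine ⟨⟨hcn, ?_, ?_, ?_⟩, ?_⟩
  · rw [hN1, coeff_zero_eq_constantCoeff_apply]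
    simp [ha0, hb0]
  · rw [hc]
    have := ha.coeff_one_pos
    have := hb.coeff_one_pos
    have := hfn 1
    have := hRn 1
    linarith
  · intro K
    -- `N(z) ≥ U(z) ≥ |K| + 2`, so that `N(z) - 1` still exceeds `K`.
    obtain ⟨z, hz0, hzρ, hUs, hUK⟩ := exists_lt_evalAt_renewal hfn hf0 hU hρ hρw hfw hfρ1
      (show 0 < |K| + 2 by positivity)
    have hzw := (hzρ.trans hρw).le
    obtain ⟨hHs, hH1⟩ := evalAt_one_add_mul ha.nonneg hb.nonneg hz0.le
      (haw.mono ha.nonneg hz0.le hzw) (hbw.mono hb.nonneg hz0.le hzw)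
    obtain ⟨hNs, hNe⟩ := evalAt_mul hHs hUs
    rw [← hNU] at hNs hNe
    have hcs : SummableAt (N - 1) z := by
      refine (Summable.sub hNs (summableAt_one z)).congr fun n => ?_
      rw [map_sub, sub_mul]
    have hce := (evalAt_one_add hcs).2
    rw [add_sub_cancel] at hce
    refine ⟨z, hz0, hcs, ?_⟩
    have : evalAt U z ≤ evalAt N z := by
      rw [hNe]
      exact le_mul_of_one_le_left (evalAt_nonneg hUn hz0.le) hH1
    have := le_abs_self K
    linarith
  · rw [hc]
    have := ha.nonneg 2
    have := hb.nonneg 2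
    have := hRn 2
    have : 0 < coeff 2 (a * b) :=
      coeff_mul_pos ha.nonneg hb.nonneg rfl ha.coeff_one_pos hb.coeff_one_pos
    linarith

/-- The coefficients of the renewal series attached to two supercritical series are asymptotically
geometric unless both series lack a quadratic term. -/
theorem Supercritical.combine_tendsto {a b N : PowerSeries ℝ} (ha : Supercritical a)
    (hb : Supercritical b) (hN : N * (1 - a * b) = (1 + a) * (1 + b))
    (h2 : 0 < coeff 2 a ∨ 0 < coeff 2 b) :
    ∃ ρ, 0 < ρ ∧ ∃ A : ℝ, 0 < A ∧ Tendsto (fun n => coeff n N * ρ ^ n) atTop (𝓝 A) := by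
  obtain ⟨ρ, w, hρ, hρw, haw, hbw, hab⟩ := ha.exists_mul_eq_one hb
  have hfn : ∀ n, 0 ≤ coeff n (a * b) := coeff_mul_nonneg ha.nonneg hb.nonneg
  have hf0 : coeff 0 (a * b) = 0 := by simp [ha.constantCoeff_eq_zero]
  obtain ⟨hfw, -⟩ := evalAt_mul haw hbw
  obtain ⟨hfρ, hfρ1⟩ :=
    evalAt_mul (haw.mono ha.nonneg hρ.le hρw.le) (hbw.mono hb.nonneg hρ.le hρw.le)
  rw [hab] at hfρ1
  obtain ⟨U, hU, hNU⟩ := ha.exists_renewal hN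
  have hf2 : 0 < coeff 2 (a * b) :=
    coeff_mul_pos ha.nonneg hb.nonneg rfl ha.coeff_one_pos hb.coeff_one_pos
  -- A quadratic term times a linear one: with the weight at 2 this gives aperiodicity.
  have hf3 : 0 < coeff 3 (a * b) := by
    rcases h2 with h2 | h2
    · exact coeff_mul_pos ha.nonneg hb.nonneg rfl h2 hb.coeff_one_pos
    · exact coeff_mul_pos ha.nonneg hb.nonneg rfl ha.coeff_one_pos h2
  have hFn := coeff_rescale_nonneg hfn hρ
  have hF0 : coeff 0 (rescale ρ (a * b)) = 0 := by rw [coeff_rescale, hf0, mul_zero]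
  have hF1 := hasSum_coeff_rescale hfρ
  rw [hfρ1] at hF1
  have hFU := rescale_renewal hU ρ
  have hFs : SummableAt (rescale ρ (a * b)) (w / ρ) := by
    refine Summable.congr hfw fun n => ?_
    rw [coeff_rescale, div_pow]
    field_simp
  obtain ⟨A, hA, hlim⟩ := renewal_tendsto hFn hF0 hF1 hFU
    (summable_tailSeries hFn hF1 ((one_lt_div hρ).2 hρw) hFs)
    (by rw [coeff_rescale]; positivity) (by rw [coeff_rescale]; positivity)
  obtain ⟨hHs, hH1⟩ := evalAt_one_add_mul ha.nonneg hb.nonneg hρ.le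
    (haw.mono ha.nonneg hρ.le hρw.le) (hbw.mono hb.nonneg hρ.le hρw.le)
  have hHn := coeff_rescale_nonneg (coeff_mul_nonneg (coeff_one_add_nonneg ha.nonneg)
    (coeff_one_add_nonneg hb.nonneg)) hρ
  have hHsum := hasSum_coeff_rescale hHs
  -- Convolving with the summable prefactor `(1 + a) * (1 + b)` multiplies the renewal limit by its
  -- value at `ρ`, which is at least 1.
  have key := tendsto_coeff_mul hHn hHsum.summable (renewal_nonneg hFn hF0 hFU)
    (renewal_le_one hFn hF0 hF1 hFU) le_rfl
    (L := fun _ => A) 0 (fun k => hlim.comp (tendsto_sub_atTop_nat k))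
  rw [tsum_mul_right, hHsum.tsum_eq, ← map_mul, ← hNU] at key
  refine ⟨ρ, hρ, _, mul_pos (one_pos.trans_le hH1) hA, key.congr fun n => ?_⟩
  rw [coeff_rescale, Nat.sub_zero, mul_comm]

end Combine

/-! ### The walk series of a quasi-transitive factor is supercritical. -/

section Factor

open PowerSeries

variable {W : Type u} {G : SimpleGraph W}

/-- The generating series of the self-avoiding walks from `o`. -/
noncomputable def sawSeries (G : SimpleGraph W) (o : W) : PowerSeries ℝ :=
  mk fun n => (sawCount G o n : ℝ)

theorem coeff_sawSeries (o : W) (n : ℕ) : coeff n (sawSeries G o) = sawCount G o n :=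
  coeff_mk _ _

theorem coeff_sawSeries_nonneg (o : W) (n : ℕ) : 0 ≤ coeff n (sawSeries G o) := by
  rw [coeff_sawSeries]
  positivity

/-- A partial sum `S` satisfies `S ≤ (sum of the first n terms) + q S`. -/
theorem summable_of_shift_le {a : ℕ → ℝ} (ha : ∀ n, 0 ≤ a n) {q : ℝ} (hq : q < 1) (n : ℕ)
    (h : ∀ m, a (m + n) ≤ q * a m) : Summable a := by
  refine summable_of_sum_range_le (c := (∑ m ∈ Finset.range n, a m) / (1 - q)) ha fun N => ?_
  rw [le_div_iff₀ (by linarith)]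
  have h1 : ∑ m ∈ Finset.range N, a m ≤ ∑ m ∈ Finset.range (n + N), a m :=
    Finset.sum_le_sum_of_subset_of_nonneg (Finset.range_mono (by omega)) fun m _ _ => ha m
  rw [Finset.sum_range_add] at h1
  have h2 : ∑ m ∈ Finset.range N, a (n + m) ≤ q * ∑ m ∈ Finset.range N, a m := by
    rw [Finset.mul_sum]
    exact Finset.sum_le_sum fun m _ => by rw [add_comm]; exact h m
  linarith

theorem summableAt_sawSeries_of_adj (hfin : ∀ x, (G.neighborSet x).Finite) {o v : W}
    (h : G.Adj o v) {z : ℝ} (hz : 0 < z) (hs : SummableAt (sawSeries G o) z) :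
    SummableAt (sawSeries G v) z := by
  have h1 : Summable fun n => coeff (n + 1) (sawSeries G o) * z ^ (n + 1) :=
    (summable_nat_add_iff (f := fun n => coeff n (sawSeries G o) * z ^ n) 1).2 hs
  have h2 := (h1.mul_left z⁻¹).add (evalAt_mul hs hs).1
  refine Summable.of_nonneg_of_le
    (fun n => mul_nonneg (coeff_sawSeries_nonneg v n) (pow_nonneg hz.le n)) (fun n => ?_) h2
  have h3 : z⁻¹ * (coeff (n + 1) (sawSeries G o) * z ^ (n + 1)) =
      coeff (n + 1) (sawSeries G o) * z ^ n := by
    rw [pow_succ]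
    field_simp
  rw [h3, ← add_mul]
  refine mul_le_mul_of_nonneg_right ?_ (pow_nonneg hz.le n)
  rw [coeff_mul]
  simp only [coeff_sawSeries]
  exact_mod_cast sawCount_le_of_adj hfin h n

theorem summableAt_sawSeries (hfin : ∀ x, (G.neighborSet x).Finite) (hconn : G.Connected)
    (o v : W) {z : ℝ} (hz : 0 < z) (hs : SummableAt (sawSeries G o) z) :
    SummableAt (sawSeries G v) z := by
  obtain ⟨p⟩ := hconn.preconnected o v
  induction p with
  | nil => exact hs
  | cons h p ih => exact ih (summableAt_sawSeries_of_adj hfin h hz hs)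

theorem sawCount_one_pos (hfin : ∀ x, (G.neighborSet x).Finite) (hconn : G.Connected)
    [Nontrivial W] (o : W) : 0 < sawCount G o 1 := by
  rw [sawCount_one, Set.ncard_pos (hfin o)]
  obtain ⟨x, hx⟩ := hconn.preconnected.exists_adj_of_nontrivial o
  exact ⟨x, hx⟩

/-- In an infinite quasi-transitive graph the series of self-avoiding walks diverges at its
radius of convergence. -/
theorem exists_lt_evalAt_sawSeries (hfin : ∀ x, (G.neighborSet x).Finite) (hconn : G.Connected)
    (hqt : IsQuasiTransitive G) (o : W) (hpos : ∀ n, 0 < sawCount G o n) (K : ℝ) :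
    ∃ z, 0 < z ∧ SummableAt (sawSeries G o) z ∧ K < evalAt (sawSeries G o) z := by
  obtain ⟨S, hSfin, hS⟩ := hqt
  set T := hSfin.toFinset with hT
  -- Summing over orbit representatives bounds the counts from every vertex, which makes `s`
  -- submultiplicative.
  set s : ℕ → ℕ := fun n => ∑ x ∈ T, sawCount G x n with hs
  have hle : ∀ x n, sawCount G x n ≤ s n := by
    intro x n
    obtain ⟨y, hy, φ, rfl⟩ := hS x
    rw [sawCount_iso]
    exact Finset.single_le_sum (f := fun x => sawCount G x n) (fun _ _ => Nat.zero_le _)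
      (hSfin.mem_toFinset.2 hy)
  have hone : ∀ n, 1 ≤ s n := fun n => (Nat.succ_le_of_lt (hpos n)).trans (hle o n)
  have hsub : ∀ m n, s (m + n) ≤ s m * s n := by
    intro m n
    rw [hs, Finset.sum_mul]
    exact Finset.sum_le_sum fun x _ => sawCount_add_le hfin x m n (s n) fun y => hle y n
  set P : PowerSeries ℝ := mk fun n => (s n : ℝ) with hP
  have hPn : ∀ n, 0 ≤ coeff n P := fun n => by rw [hP, coeff_mk]; positivity
  -- One `n` with `s n * z ^ n < 1` forces convergence at `z`. This condition is open in `z`, so `P`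
  -- cannot converge at the supremum `R` of its domain.
  have hcrit : ∀ z, 0 < z → ∀ n, (s n : ℝ) * z ^ n < 1 → SummableAt P z := by
    intro z hz n hn
    refine summable_of_shift_le (fun m => mul_nonneg (hPn m) (pow_nonneg hz.le m)) hn n fun m => ?_
    rw [hP, coeff_mk, coeff_mk, pow_add]
    have : (s (m + n) : ℝ) ≤ s m * s n := by exact_mod_cast hsub m n
    calc (s (m + n) : ℝ) * (z ^ m * z ^ n) ≤ (s m * s n) * (z ^ m * z ^ n) := by gcongr
      _ = _ := by ring
  set D := {z : ℝ | 0 < z ∧ SummableAt P z} with hD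
  have hDbdd : ∀ z ∈ D, z < 1 := by
    rintro z ⟨hz, hsum⟩
    by_contra! h1
    obtain ⟨n, hn⟩ := ((Summable.tendsto_atTop_zero hsum).eventually (gt_mem_nhds one_pos)).exists
    rw [hP, coeff_mk] at hn
    have h2 : (1 : ℝ) ≤ s n := by exact_mod_cast hone n
    have h3 : 1 ≤ z ^ n := one_le_pow₀ h1
    nlinarith
  have hDne : D.Nonempty := by
    refine ⟨1 / (s 1 + 1), by positivity, hcrit _ (by positivity) 1 ?_⟩
    rw [pow_one, mul_one_div, div_lt_one (by positivity)]
    linarith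
  have hbdd : BddAbove D := ⟨1, fun z hz => (hDbdd z hz).le⟩
  obtain ⟨d, hd⟩ := hDne
  have hR : 0 < sSup D := hd.1.trans_le (le_csSup hbdd hd)
  set R := sSup D with hRdef
  have hRD : ¬ SummableAt P R := by
    intro hsum
    obtain ⟨n, hn⟩ := ((Summable.tendsto_atTop_zero hsum).eventually (gt_mem_nhds one_pos)).exists
    rw [hP, coeff_mk] at hn
    have hcont : ContinuousAt (fun z : ℝ => (s n : ℝ) * z ^ n) R := by fun_prop
    have hev : ∀ᶠ z in 𝓝[>] R, (s n : ℝ) * z ^ n < 1 :=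
      (hcont.tendsto.eventually (gt_mem_nhds hn)).filter_mono nhdsWithin_le_nhds
    obtain ⟨z, hz, hzR⟩ := (hev.and self_mem_nhdsWithin).exists
    have hz0 : 0 < z := hR.trans hzR
    exact absurd (le_csSup hbdd (show z ∈ D from ⟨hz0, hcrit z hz0 n hz⟩)) (not_le.2 hzR)
  by_contra! hcon
  -- A bound `K` below `R` passes to the partial sums at `R`. Convergence then spreads from `o` to
  -- all representatives, hence to `P`, a contradiction.
  have hsaw : SummableAt (sawSeries G o) R := by
    refine summable_of_sum_range_le (c := K)
      (fun n => mul_nonneg (coeff_sawSeries_nonneg o n) (pow_nonneg hR.le n)) fun N => ?_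
    have hcont : ContinuousAt
        (fun z : ℝ => ∑ n ∈ Finset.range N, coeff n (sawSeries G o) * z ^ n) R := by fun_prop
    refine le_of_tendsto (hcont.tendsto.mono_left (nhdsWithin_le_nhds (s := Set.Iio R))) ?_
    filter_upwards [Ioo_mem_nhdsLT hR] with z hz
    obtain ⟨d, hd, hzd⟩ := exists_lt_of_lt_csSup ⟨d, hd⟩ hz.2
    have hPz : SummableAt P z := SummableAt.mono hPn hz.1.le hzd.le hd.2
    have hsz : SummableAt (sawSeries G o) z := by
      refine Summable.of_nonneg_of_le
        (fun n => mul_nonneg (coeff_sawSeries_nonneg o n) (pow_nonneg hz.1.le n)) (fun n => ?_) hPz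
      refine mul_le_mul_of_nonneg_right ?_ (pow_nonneg hz.1.le n)
      rw [coeff_sawSeries, hP, coeff_mk]
      exact_mod_cast hle o n
    exact (Summable.sum_le_tsum _
      (fun n _ => mul_nonneg (coeff_sawSeries_nonneg o n) (pow_nonneg hz.1.le n)) hsz).trans
      (hcon z hz.1 hsz)
  refine hRD ?_
  have hsum : Summable fun n => ∑ x ∈ T, coeff n (sawSeries G x) * R ^ n :=
    summable_sum fun x _ => summableAt_sawSeries hfin hconn o x hR hsaw
  refine hsum.congr fun n => ?_
  rw [hP, coeff_mk, hs, ← Finset.sum_mul]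
  simp [coeff_sawSeries]

/-- The nontrivial self-avoiding walks of a quasi-transitive graph form a supercritical series. -/
theorem supercritical_sawSeries_sub_one (hfin : ∀ x, (G.neighborSet x).Finite)
    (hconn : G.Connected) [Nontrivial W] (hqt : IsQuasiTransitive G) (o : W) :
    Supercritical (sawSeries G o - 1) := by
  have hcoeff : ∀ n, coeff n (sawSeries G o - 1) = if n = 0 then 0 else (sawCount G o n : ℝ) := by
    intro n
    rw [map_sub, coeff_one, coeff_sawSeries]
    split_ifs with h
    · rw [h, sawCount_zero, Nat.cast_one, sub_self]
    · rw [sub_zero]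
  have hnn : ∀ n, 0 ≤ coeff n (sawSeries G o - 1) := by
    intro n
    rw [hcoeff]
    positivity
  have h1 : 0 < coeff 1 (sawSeries G o - 1) := by
    rw [hcoeff]
    simpa using sawCount_one_pos hfin hconn o
  refine ⟨hnn, by rw [hcoeff, if_pos rfl], h1, fun K => ?_⟩
  by_cases hpos : ∀ n, 0 < sawCount G o n
  · obtain ⟨z, hz, hs, hK⟩ := exists_lt_evalAt_sawSeries hfin hconn hqt o hpos (K + 1)
    have hs' : SummableAt (sawSeries G o - 1) z := by
      refine (Summable.sub hs (summableAt_one z)).congr fun n => ?_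
      rw [map_sub, sub_mul]
    refine ⟨z, hz, hs', ?_⟩
    have := (evalAt_one_add hs').2
    rw [add_sub_cancel] at this
    linarith
  -- Here the series is a polynomial, and `z` is chosen to make its linear term equal to `|K| + 1`.
  · push Not at hpos
    obtain ⟨N, hN⟩ := hpos
    set c := coeff 1 (sawSeries G o - 1) with hc
    have hz : 0 < (|K| + 1) / c := by positivity
    have hs : SummableAt (sawSeries G o - 1) ((|K| + 1) / c) := by
      refine summable_of_ne_finset_zero (s := Finset.range N) fun n hn => ?_
      have : sawCount G o n = 0 :=
        sawCount_eq_zero_of_le hfin (by simpa using hn) (Nat.le_zero.1 hN)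
      rw [hcoeff, this]
      simp
    refine ⟨_, hz, hs, ?_⟩
    have h3 : c * ((|K| + 1) / c) ^ 1 ≤ evalAt (sawSeries G o - 1) ((|K| + 1) / c) :=
      Summable.le_tsum hs 1 fun n _ => mul_nonneg (hnn n) (pow_nonneg hz.le n)
    have h4 : c * ((|K| + 1) / c) ^ 1 = |K| + 1 := by field_simp
    have := le_abs_self K
    linarith

end Factor


/-! ### Block decomposition of self-avoiding walks on the free product. -/

section Decomposition

variable {ι : Type u} {V : ι → Type v} {o : ∀ i, V i}

/-- The word `w` does not end in a letter of type `i`. -/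
def Word.NotEndsIn (w : Word o) (i : ι) : Prop :=
  ∀ c ∈ w.1.getLast?, c.1 ≠ i

open Classical in
/-- The word `w x`, provided that `w` does not end in a letter of type `i`. -/
noncomputable def Word.app (w : Word o) (i : ι) (x : V i) : Word o :=
  if h : w.NotEndsIn i then
    ⟨w.1 ++ single o i x, by
      rw [List.isChain_append]
      refine ⟨w.2, ?_, ?_⟩
      · unfold single
        split_ifs <;> simp
      · intro c hc d hd
        unfold single at hd
        split_ifs at hd
        · simp at hd
        · simp only [List.head?_cons, Option.mem_some_iff] at hd
          rw [← hd]
          exact h c hc⟩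
  else w

theorem Word.app_val {w : Word o} {i : ι} (h : w.NotEndsIn i) (x : V i) :
    (w.app i x).1 = w.1 ++ single o i x := by
  exact congrArg Subtype.val (dif_pos h)

theorem single_root (i : ι) : single o i (o i) = [] := by
  rw [single, dif_pos rfl]

theorem single_of_ne {i : ι} {x : V i} (hx : x ≠ o i) : single o i x = [⟨i, x, hx⟩] := by
  rw [single, dif_neg hx]

theorem length_single_le (i : ι) (x : V i) : (single o i x).length ≤ 1 := by
  unfold single
  split_ifs <;> simp

theorem Word.app_root {w : Word o} {i : ι} (h : w.NotEndsIn i) : w.app i (o i) = w :=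
  Subtype.ext (by rw [Word.app_val h, single_root, List.append_nil])

theorem Word.app_injective {w : Word o} {i : ι} (h : w.NotEndsIn i) :
    Function.Injective (w.app i) := by
  intro x y hxy
  have := congrArg Subtype.val hxy
  rw [Word.app_val h, Word.app_val h] at this
  exact single_injective o i (List.append_cancel_left this)

theorem Word.app_eq_self_iff {w : Word o} {i : ι} (h : w.NotEndsIn i) {x : V i} :
    w.app i x = w ↔ x = o i := by
  conv_lhs => rhs; rw [← Word.app_root h]
  exact (Word.app_injective h).eq_iff

theorem Word.notEndsIn_empty (i : ι) : (Word.empty o).NotEndsIn i := by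
  intro c hc
  simp [Word.empty] at hc

theorem Word.app_notEndsIn_iff {w : Word o} {i : ι} (h : w.NotEndsIn i) {x : V i} (hx : x ≠ o i)
    (j : ι) : (w.app i x).NotEndsIn j ↔ i ≠ j := by
  rw [Word.NotEndsIn, Word.app_val h, single_of_ne hx]
  simp

theorem Word.app_eq_app_iff {w w' : Word o} {i j : ι} (h : w.NotEndsIn i) (h' : w'.NotEndsIn j)
    {x : V i} {y : V j} (hx : x ≠ o i) (hy : y ≠ o j) :
    w.app i x = w'.app j y ↔ w = w' ∧ (⟨i, x⟩ : Σ i, V i) = ⟨j, y⟩ := by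
  constructor
  · intro he
    have := congrArg Subtype.val he
    rw [Word.app_val h, Word.app_val h', single_of_ne hx, single_of_ne hy] at this
    obtain ⟨h1, h2⟩ := List.append_inj' this rfl
    refine ⟨Subtype.ext h1, ?_⟩
    have h3 := (List.cons.inj h2).1
    exact congrArg (fun c : Letter o => (⟨c.1, c.2.1⟩ : Σ i, V i)) h3
  · rintro ⟨rfl, h2⟩
    cases h2
    rfl

variable {G : ∀ i, SimpleGraph (V i)}

theorem freeProduct_adj_app {w : Word o} {i : ι} (h : w.NotEndsIn i) {x y : V i}
    (hxy : (G i).Adj x y) : (freeProduct G o).Adj (w.app i x) (w.app i y) :=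
  ⟨w, i, x, y, h, hxy, Word.app_val h x, Word.app_val h y⟩

theorem exists_app_of_freeProduct_adj {a b : Word o} (hab : (freeProduct G o).Adj a b) :
    ∃ (w : Word o) (i : ι) (x y : V i), w.NotEndsIn i ∧ (G i).Adj x y ∧
      a = w.app i x ∧ b = w.app i y := by
  obtain ⟨w, i, x, y, h, hxy, ha, hb⟩ := hab
  exact ⟨w, i, x, y, h, hxy, Subtype.ext (ha.trans (Word.app_val h x).symm),
    Subtype.ext (hb.trans (Word.app_val h y).symm)⟩

/-- A self-avoiding walk `p` of length `n` whose last block, in a copy of `G i`, is `w q`. -/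
def HasLastBlock (G : ∀ i, SimpleGraph (V i)) (p : List (Word o)) (n : ℕ) (w : Word o) (i : ι)
    (q : List (V i)) (t : List (Word o)) : Prop :=
  p = q.map (w.app i) ++ w :: t ∧ w.NotEndsIn i ∧ q ≠ [] ∧
    q ++ [o i] ∈ saws (G i) (o i) q.length ∧ q.length + t.length = n ∧
    w :: t ∈ saws (freeProduct G o) (Word.empty o) t.length

/-- No vertex visited before the endpoint lies in the cone of the endpoint. -/
def ConeFree (p : List (Word o)) : Prop :=
  ∀ v t, p = v :: t → ∀ y ∈ t, ¬ v.1 <+: y.1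

/-- The endpoint is `w x` with `x` a letter. Vertices of the same block are no longer as words, so
having `w x` as a prefix would make them equal to it. The vertex `w` is too short, and an earlier
vertex in the cone of `w x` would lie in that of `w`. -/
theorem HasLastBlock.coneFree {p : List (Word o)} {n : ℕ} {w : Word o} {i : ι} {q : List (V i)}
    {t : List (Word o)} (h : HasLastBlock G p n w i q t) (hw : ConeFree (w :: t)) :
    ConeFree p := by
  obtain ⟨rfl, hi, hq, hsaw, -, -⟩ := h
  intro v s hvs y hy hpre
  cases q with
  | nil => exact hq rfl
  | cons x q =>
    have hnd := hsaw.2.1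
    simp only [List.cons_append, List.nodup_cons, List.mem_append, List.mem_singleton,
      not_or] at hnd
    simp only [List.map_cons, List.cons_append, List.cons.injEq] at hvs
    obtain ⟨rfl, rfl⟩ := hvs
    have hval := Word.app_val hi x
    rw [single_of_ne hnd.1.2] at hval
    simp only [List.mem_append, List.mem_map, List.mem_cons] at hy
    rcases hy with ⟨x', hx', rfl⟩ | rfl | hy
    · have hlen : (w.app i x').1.length ≤ (w.app i x).1.length := by
        rw [hval, Word.app_val hi]
        have := length_single_le (o := o) i x'
        simpa using this
      have := Word.app_injective hi (Subtype.ext (hpre.eq_of_length_le hlen))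
      exact hnd.1.1 (this ▸ hx')
    · have := hpre.length_le
      rw [hval] at this
      simp at this
    · refine hw w t rfl y hy (List.IsPrefix.trans ?_ hpre)
      rw [hval]
      exact List.prefix_append _ _

theorem coneFree_and_exists_hasLastBlock (n : ℕ) (p : List (Word o))
    (hp : p ∈ saws (freeProduct G o) (Word.empty o) n) :
    ConeFree p ∧ (n = 0 ∨ ∃ w i q t, HasLastBlock G p n w i q t) := by
  induction n using Nat.strong_induction_on generalizing p with
  | _ n ih =>
    have key : n = 0 ∨ ∃ w i q t, HasLastBlock G p n w i q t := by
      cases n with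
      | zero => exact Or.inl rfl
      | succ n =>
        right
        obtain ⟨v, u, t, rfl⟩ := exists_eq_cons_cons_of_mem_saws hp
        obtain ⟨hadj, hnot, hut⟩ := cons_mem_saws.1 hp
        obtain ⟨w, j, x, y, hj, hxy, rfl, rfl⟩ := exists_app_of_freeProduct_adj hadj
        have htn : t.length = n := by simpa using hut.2.2.1
        -- The last edge goes from `w y` to `w x`. If `y` is the root, it opens a new block at `w`;
        -- otherwise `w y` ends in type `j`, so the preceding block lies in the same copy of `G j`
        -- and the edge extends it.
        by_cases hy : y = o j
        · subst hy
          rw [Word.app_root hj] at hut ⊢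
          refine ⟨w, j, [x], t, rfl, hj, by simp, ?_, ?_, htn ▸ hut⟩
          · exact cons_mem_saws.2 ⟨hxy, by simpa using hxy.ne, mem_saws_zero.2 rfl⟩
          · simp [htn, add_comm]
        · rcases (ih n (Nat.lt_succ_self n) _ hut).2 with rfl | ⟨w', i, q, s, hb⟩
          · have := mem_saws_zero.1 hut
            have he : w.app j y = Word.empty o := (List.cons.inj this).1
            have := congrArg (fun w => w.1.length) he
            simp [Word.app_val hj, single_of_ne hy, Word.empty] at this
          · obtain ⟨heq, hi, hq, hsaw, hlen, hws⟩ := hb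
            cases q with
            | nil => exact absurd rfl hq
            | cons z q =>
              have hnd := hsaw.2.1
              simp only [List.cons_append, List.nodup_cons, List.mem_append, List.mem_singleton,
                not_or] at hnd
              have heq' := heq
              simp only [List.map_cons, List.cons_append, List.cons.injEq] at heq'
              obtain ⟨rfl, hs⟩ := (Word.app_eq_app_iff hj hi hy hnd.1.2).1 heq'.1
              cases hs
              refine ⟨w, j, x :: y :: q, s, ?_, hj, by simp, ?_, ?_, hws⟩
              · rw [heq]
                rfl
              · refine cons_mem_saws.2 ⟨hxy, ?_, hsaw⟩
                intro hmem
                rw [heq] at hnot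
                apply hnot
                replace hmem : x ∈ (y :: q) ++ [o j] := hmem
                rw [List.mem_append, List.mem_singleton] at hmem
                rcases hmem with hmem | rfl
                -- The extended block is self-avoiding because the walk is; in particular `x = o j`
                -- would be a return to `w`.
                · exact List.mem_append_left _ (List.mem_map_of_mem hmem)
                · rw [Word.app_root hj]
                  exact List.mem_append_right _ List.mem_cons_self
              · simp only [List.length_cons] at hlen ⊢
                omega
    refine ⟨?_, key⟩
    rcases key with rfl | ⟨w, i, q, t, hb⟩
    · rw [mem_saws_zero.1 hp]
      intro v t hvt y hy
      obtain ⟨-, rfl⟩ : _ ∧ [] = t := by simpa using hvt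
      simp at hy
    · refine hb.coneFree ?_
      obtain ⟨-, -, hq, -, hlen, hws⟩ := hb
      have := List.length_pos_iff.2 hq
      exact (ih t.length (by omega) _ hws).1

/-- Converse of the decomposition: the new vertices lie in the cone of `w`, and by cone-freeness
none of them was visited before. -/
theorem map_app_append_mem_saws {w : Word o} {i : ι} (hi : w.NotEndsIn i) {t : List (Word o)}
    {m : ℕ} (hw : w :: t ∈ saws (freeProduct G o) (Word.empty o) m) (q : List (V i)) (k : ℕ)
    (hq : q ++ [o i] ∈ saws (G i) (o i) k) :
    q.map (w.app i) ++ w :: t ∈ saws (freeProduct G o) (Word.empty o) (k + m) := by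
  have hcone := (coneFree_and_exists_hasLastBlock m _ hw).1
  induction q generalizing k with
  | nil =>
    have : k = 0 := by simpa using hq.2.2.1.symm
    subst this
    simpa using hw
  | cons x q ih =>
    have hk : k = q.length + 1 := by
      have := hq.2.2.1
      simp at this
      omega
    subst hk
    obtain ⟨y, s, hys⟩ : ∃ y s, q ++ [o i] = y :: s := by
      cases q with
      | nil => exact ⟨_, _, rfl⟩
      | cons y q => exact ⟨_, _, rfl⟩
    rw [List.cons_append, hys, cons_mem_saws] at hq
    obtain ⟨hxy, hx, hs⟩ := hq
    have hmem := ih q.length (hys ▸ hs)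
    rw [← hys] at hx
    simp only [List.mem_append, List.mem_singleton, not_or] at hx
    have hnot : w.app i x ∉ q.map (w.app i) ++ w :: t := by
      simp only [List.mem_append, List.mem_cons, not_or, List.mem_map, not_exists, not_and]
      refine ⟨fun z hz h => hx.1 (Word.app_injective hi h ▸ hz),
        fun h => hx.2 ((Word.app_eq_self_iff hi).1 h), fun h => ?_⟩
      refine hcone w t rfl _ h ?_
      rw [Word.app_val hi]
      exact List.prefix_append _ _
    have hadj : ∃ s', q.map (w.app i) ++ w :: t = w.app i y :: s' := by
      cases q with
      | nil =>
        have : y = o i := by simpa using (List.cons.inj hys).1.symm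
        exact ⟨t, by rw [this, Word.app_root hi]; rfl⟩
      | cons z q =>
        have : z = y := (List.cons.inj hys).1
        exact ⟨_, by rw [← this]; rfl⟩
    obtain ⟨s', hs'⟩ := hadj
    rw [List.map_cons, List.cons_append, hs', show q.length + 1 + m = q.length + m + 1 by omega,
      cons_mem_saws]
    rw [hs'] at hmem hnot
    exact ⟨freeProduct_adj_app hi hxy, hnot, hmem⟩

end Decomposition

/-! ### The generating series of the free product. -/

section Count

variable {ι : Type u} {V : ι → Type v} {o : ∀ i, V i} {G : ∀ i, SimpleGraph (V i)}

/-- The self-avoiding walk `p` followed by the translate of the walk `l` of `G i`. -/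
noncomputable def glue (i : ι) (l : List (V i)) (p : List (Word o)) : List (Word o) :=
  l.dropLast.map ((p.headD (Word.empty o)).app i) ++ p

theorem HasLastBlock.eq_glue {p : List (Word o)} {n : ℕ} {w : Word o} {i : ι} {q : List (V i)}
    {t : List (Word o)} (h : HasLastBlock G p n w i q t) : p = glue i (q ++ [o i]) (w :: t) := by
  rw [h.1, glue]
  simp

/-- Every nontrivial walk is glued from a strictly shorter one and a walk in one of finitely many
factors. Finiteness is needed for the `ncard` identities below to be meaningful. -/
theorem finite_saws_freeProduct [Finite ι] (hfin : ∀ i x, ((G i).neighborSet x).Finite) (n : ℕ) :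
    (saws (freeProduct G o) (Word.empty o) n).Finite := by
  induction n using Nat.strong_induction_on with
  | _ n ih =>
    have hbig : ({[Word.empty o]} ∪ ⋃ i : ι, ⋃ k ∈ Set.Iic n, ⋃ m ∈ Set.Iio n,
        Set.image2 (glue i) (saws (G i) (o i) k)
          (saws (freeProduct G o) (Word.empty o) m)).Finite := by
      refine (Set.finite_singleton _).union (Set.finite_iUnion fun i => ?_)
      refine (Set.finite_Iic n).biUnion fun k _ => (Set.finite_Iio n).biUnion fun m hm => ?_
      exact (finite_saws (hfin i) (o i) k).image2 _ (ih m hm)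
    refine hbig.subset fun p hp => ?_
    rcases (coneFree_and_exists_hasLastBlock n p hp).2 with rfl | ⟨w, i, q, t, hb⟩
    · exact Or.inl (mem_saws_zero.1 hp)
    · right
      have := List.length_pos_iff.2 hb.2.2.1
      have := hb.2.2.2.2.1
      have hk : q.length ∈ Set.Iic n := by
        rw [Set.mem_Iic]
        omega
      have hm : t.length ∈ Set.Iio n := by
        rw [Set.mem_Iio]
        omega
      simp only [Set.mem_iUnion]
      exact ⟨i, q.length, hk, t.length, hm,
        _, hb.2.2.2.1, _, hb.2.2.2.2.2, hb.eq_glue.symm⟩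

/-- The self-avoiding walks whose endpoint ends in a letter of type `i`. -/
def sawsEnd (G : ∀ i, SimpleGraph (V i)) (o : ∀ i, V i) (i : ι) (n : ℕ) : Set (List (Word o)) :=
  {p | p ∈ saws (freeProduct G o) (Word.empty o) n ∧
    ¬ (p.headD (Word.empty o)).NotEndsIn i}

/-- The self-avoiding walks whose endpoint does not end in a letter of type `i`. -/
def sawsNotEnd (G : ∀ i, SimpleGraph (V i)) (o : ∀ i, V i) (i : ι) (n : ℕ) :
    Set (List (Word o)) :=
  {p | p ∈ saws (freeProduct G o) (Word.empty o) n ∧ (p.headD (Word.empty o)).NotEndsIn i}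

theorem ncard_sawsEnd_add [Finite ι] (hfin : ∀ i x, ((G i).neighborSet x).Finite) (i : ι) (n : ℕ) :
    (sawsEnd G o i n).ncard + (sawsNotEnd G o i n).ncard =
      sawCount (freeProduct G o) (Word.empty o) n := by
  have hf := finite_saws_freeProduct (o := o) hfin n
  rw [sawCount_eq_ncard, ← Set.ncard_union_eq ?_ (hf.subset fun p hp => hp.1)
    (hf.subset fun p hp => hp.1)]
  · congr 1
    ext p
    simp only [sawsEnd, sawsNotEnd, Set.mem_union, Set.mem_ofPred_eq]
    tauto
  · rw [Set.disjoint_left]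
    exact fun p hp hp' => hp.2 hp'.2

theorem sawCount_freeProduct [Fintype ι] (hfin : ∀ i x, ((G i).neighborSet x).Finite) (n : ℕ) :
    sawCount (freeProduct G o) (Word.empty o) n =
      (if n = 0 then 1 else 0) + ∑ i, (sawsEnd G o i n).ncard := by
  classical
  have hf := finite_saws_freeProduct (o := o) hfin n
  by_cases hn : n = 0
  · subst hn
    rw [sawCount_zero, if_pos rfl, left_eq_add]
    refine Finset.sum_eq_zero fun i _ => ?_
    rw [Set.ncard_eq_zero (hf.subset fun p hp => hp.1)]
    refine Set.eq_empty_of_forall_notMem fun p hp => hp.2 ?_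
    rw [mem_saws_zero.1 hp.1]
    exact Word.notEndsIn_empty i
  · rw [if_neg hn, zero_add, sawCount_eq_ncard]
    have hsub : ∀ i, (sawsEnd G o i n).Finite := fun i => hf.subset fun p hp => hp.1
    have hunion : hf.toFinset = Finset.univ.biUnion fun i => (hsub i).toFinset := by
      ext p
      simp only [Set.Finite.mem_toFinset, Finset.mem_biUnion, Finset.mem_univ, true_and]
      refine ⟨fun hp => ?_, fun ⟨i, hp⟩ => hp.1⟩
      rcases (coneFree_and_exists_hasLastBlock n p hp).2 with h | ⟨w, i, q, t, hb⟩
      · exact absurd h hn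
      · obtain ⟨rfl, hi, hq, hsaw, -, -⟩ := hb
        cases q with
        | nil => exact absurd rfl hq
        | cons x q =>
          have hnd := hsaw.2.1
          simp only [List.cons_append, List.nodup_cons, List.mem_append, List.mem_singleton,
            not_or] at hnd
          refine ⟨i, hp, ?_⟩
          change ¬ (w.app i x).NotEndsIn i
          rw [Word.app_notEndsIn_iff hi hnd.1.2]
          simp
    rw [Set.ncard_eq_toFinset_card _ hf, hunion, Finset.card_biUnion]
    · exact Finset.sum_congr rfl fun i _ => (Set.ncard_eq_toFinset_card _ (hsub i)).symm
    · intro i _ j _ hij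
      refine Finset.disjoint_left.2 ?_
      intro p hp hp'
      rw [Set.Finite.mem_toFinset] at hp hp'
      have h1 := hp.2
      have h2 := hp'.2
      simp only [Word.NotEndsIn, not_forall, not_not] at h1 h2
      obtain ⟨c, hc, hci⟩ := h1
      obtain ⟨d, hd, hdj⟩ := h2
      exact hij (hci.symm.trans ((congrArg Sigma.fst (Option.mem_unique hc hd)).trans hdj))

/-- Gluing is a bijection: removing the last block, of type `i` and positive length, leaves a walk
whose endpoint does not end in type `i`. -/
theorem ncard_sawsEnd [Finite ι] (hfin : ∀ i x, ((G i).neighborSet x).Finite) (i : ι) (n : ℕ) :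
    (sawsEnd G o i n).ncard = ∑ k ∈ Finset.HasAntidiagonal.antidiagonal n,
      (if k.1 = 0 then 0 else sawCount (G i) (o i) k.1) * (sawsNotEnd G o i k.2).ncard := by
  classical
  have hf := fun n => finite_saws_freeProduct (o := o) hfin n
  have hE : (sawsEnd G o i n).Finite := (hf n).subset fun p hp => hp.1
  have hN : ∀ m, (sawsNotEnd G o i m).Finite := fun m => (hf m).subset fun p hp => hp.1
  have hdecomp : ∀ k m l p, k ≠ 0 → l ∈ saws (G i) (o i) k → p ∈ sawsNotEnd G o i m →
      ∃ x q w t, l = x :: q ++ [o i] ∧ p = w :: t ∧ w.NotEndsIn i ∧ x ≠ o i ∧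
        q.length + 1 = k ∧ t.length = m ∧ glue i l p = (x :: q).map (w.app i) ++ w :: t ∧
        glue i l p ∈ saws (freeProduct G o) (Word.empty o) (k + m) := by
    intro k m l p hk hl hp
    obtain ⟨q, rfl, hq⟩ := append_singleton_of_mem_saws hl
    obtain ⟨w, t, rfl⟩ := exists_eq_cons_of_mem_saws hp.1
    have hi : w.NotEndsIn i := hp.2
    cases q with
    | nil => exact absurd hq.symm hk
    | cons x q =>
      have hnd := hl.2.1
      simp only [List.cons_append, List.nodup_cons, List.mem_append, List.mem_singleton,
        not_or] at hnd
      have hg : glue i (x :: q ++ [o i]) (w :: t) = (x :: q).map (w.app i) ++ w :: t := by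
        rw [glue, List.dropLast_concat]
        rfl
      refine ⟨x, q, w, t, rfl, rfl, hi, hnd.1.2, hq, by simpa using hp.1.2.2.1, hg, ?_⟩
      rw [hg]
      exact map_app_append_mem_saws hi hp.1 _ _ hl
  have hcard : ∑ k ∈ Finset.HasAntidiagonal.antidiagonal n,
      (if k.1 = 0 then 0 else sawCount (G i) (o i) k.1) * (sawsNotEnd G o i k.2).ncard =
      ((Finset.HasAntidiagonal.antidiagonal n).sigma fun k =>
        if k.1 = 0 then ∅ else sawFinset (hfin i) (o i) k.1 ×ˢ (hN k.2).toFinset).card := by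
    rw [Finset.card_sigma]
    refine Finset.sum_congr rfl fun k _ => ?_
    split_ifs
    · simp
    · rw [Finset.card_product, card_sawFinset, Set.ncard_eq_toFinset_card _ (hN k.2)]
  have hmem : ∀ s : (Σ _ : ℕ × ℕ, List (V i) × List (Word o)),
      s ∈ ((Finset.HasAntidiagonal.antidiagonal n).sigma fun k =>
        if k.1 = 0 then ∅ else sawFinset (hfin i) (o i) k.1 ×ˢ (hN k.2).toFinset) ↔
      s.1.1 + s.1.2 = n ∧ s.1.1 ≠ 0 ∧ s.2.1 ∈ saws (G i) (o i) s.1.1 ∧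
        s.2.2 ∈ sawsNotEnd G o i s.1.2 := by
    rintro ⟨⟨k, m⟩, l, p⟩
    rw [Finset.mem_sigma, Finset.HasAntidiagonal.mem_antidiagonal]
    by_cases hk : k = 0
    · simp [hk]
    · simp [hk, mem_sawFinset]
  rw [hcard, Set.ncard_eq_toFinset_card _ hE]
  symm
  refine Finset.card_nbij (fun s => glue i s.2.1 s.2.2) ?_ ?_ ?_
  · rintro ⟨⟨k, m⟩, l, p⟩ hs
    obtain ⟨hkm, hk, hl, hp⟩ := (hmem _).1 hs
    obtain ⟨x, q, w, t, -, -, hi, hx, -, -, hg, hsaw⟩ := hdecomp k m l p hk hl hp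
    rw [Finset.mem_coe, Set.Finite.mem_toFinset]
    refine ⟨hkm ▸ hsaw, ?_⟩
    change ¬ ((glue i l p).headD _).NotEndsIn i
    rw [hg]
    change ¬ (w.app i x).NotEndsIn i
    rw [Word.app_notEndsIn_iff hi hx]
    simp
  · rintro ⟨⟨k, m⟩, l, p⟩ hs ⟨⟨k', m'⟩, l', p'⟩ hs' heq
    obtain ⟨hkm, hk, hl, hp⟩ := (hmem _).1 hs
    obtain ⟨hkm', hk', hl', hp'⟩ := (hmem _).1 hs'
    obtain ⟨x, q, w, t, rfl, rfl, hi, hx, hq, ht, hg, hsaw⟩ := hdecomp k m l p hk hl hp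
    obtain ⟨x', q', w', t', rfl, rfl, hi', hx', hq', ht', hg', -⟩ := hdecomp k' m' l' p' hk' hl' hp'
    change glue i _ _ = glue i _ _ at heq
    have hnd := hsaw.2.1
    rw [hg] at hnd
    rw [hg, hg'] at heq
    have hhead : w.app i x = w'.app i x' := (List.cons.inj heq).1
    obtain ⟨rfl, -⟩ := (Word.app_eq_app_iff hi hi' hx hx').1 hhead
    rw [List.nodup_append, List.nodup_cons] at hnd
    -- The endpoint determines `w`, and a self-avoiding walk visits `w` once, so the cutting place
    -- is unique.
    obtain ⟨h1, -, h2⟩ := (List.append_cons_inj_of_notMem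
      (fun h => hnd.2.2 w h w List.mem_cons_self rfl) hnd.2.1.1).1 heq
    have h3 := (List.map_injective_iff.2 (Word.app_injective hi)) h1
    cases h3
    cases h2
    subst hq hq' ht ht'
    rfl
  · intro p hp
    rw [Finset.mem_coe, Set.Finite.mem_toFinset] at hp
    rcases (coneFree_and_exists_hasLastBlock n p hp.1).2 with h | ⟨w, j, q, t, hb⟩
    · subst h
      refine absurd ?_ hp.2
      rw [mem_saws_zero.1 hp.1]
      exact Word.notEndsIn_empty i
    · have hg := hb.eq_glue
      obtain ⟨hpeq, hj, hq, hsaw, hlen, hws⟩ := hb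
      have hji : j = i := by
        have h2 := hp.2
        rw [hpeq] at h2
        cases q with
        | nil => exact absurd rfl hq
        | cons x q =>
          have hnd := hsaw.2.1
          simp only [List.cons_append, List.nodup_cons, List.mem_append, List.mem_singleton,
            not_or] at hnd
          change ¬ (w.app j x).NotEndsIn i at h2
          rw [Word.app_notEndsIn_iff hj hnd.1.2] at h2
          exact not_not.1 h2
      subst hji
      refine ⟨⟨(q.length, t.length), q ++ [o j], w :: t⟩, ?_, hg.symm⟩
      rw [Finset.mem_coe, hmem]
      refine ⟨hlen, ?_, hsaw, hws, hj⟩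
      have := List.length_pos_iff.2 hq
      exact this.ne'

open PowerSeries

/-- The generating series of the free product in terms of those of its factors. -/
theorem sawSeries_freeProduct [Fintype ι] (hfin : ∀ i x, ((G i).neighborSet x).Finite) :
    sawSeries (freeProduct G o) (Word.empty o) *
      (1 - ∑ i, (sawSeries (G i) (o i) - 1) * (sawSeries (G i) (o i))⁻¹) = 1 := by
  set σ := sawSeries (freeProduct G o) (Word.empty o) with hσ
  let E : ι → PowerSeries ℝ := fun i => mk fun n => ((sawsEnd G o i n).ncard : ℝ)
  have h1 : σ = 1 + ∑ i, E i := by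
    ext n
    rw [map_add, map_sum, coeff_one, hσ, coeff_sawSeries, sawCount_freeProduct hfin n]
    simp [E]
  have h2 : ∀ i, E i = (sawSeries (G i) (o i) - 1) * (σ - E i) := by
    intro i
    ext n
    rw [coeff_mul, coeff_mk, ncard_sawsEnd hfin i n, Nat.cast_sum]
    refine Finset.sum_congr rfl fun k _ => ?_
    rw [Nat.cast_mul]
    congr 1
    · rw [map_sub, coeff_one, coeff_sawSeries]
      split_ifs with h
      · rw [h, sawCount_zero]
        simp
      · simp
    · rw [map_sub, hσ, coeff_sawSeries, coeff_mk, ← ncard_sawsEnd_add hfin i k.2]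
      push_cast
      ring
  -- Solving `h2` for `E i`: its coefficient is the whole walk series of `G i`, which is invertible
  -- because its constant term is 1.
  have h3 : ∀ i, σ * ((sawSeries (G i) (o i) - 1) * (sawSeries (G i) (o i))⁻¹) = E i := by
    intro i
    have hinv : sawSeries (G i) (o i) * (sawSeries (G i) (o i))⁻¹ = 1 := by
      refine PowerSeries.mul_inv_cancel _ ?_
      rw [← coeff_zero_eq_constantCoeff_apply, coeff_sawSeries, sawCount_zero]
      simp
    linear_combination (E i) * hinv - (sawSeries (G i) (o i))⁻¹ * h2 i
  rw [mul_sub, mul_one, Finset.mul_sum]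
  simp only [h3]
  rw [h1]
  ring

end Count


/-! ### Merging finitely many factors. -/

section Families

open PowerSeries

/-- With `N'` the series for the remaining factors, this brings the sum formula into the two-series
form used by `combine` and `combine_tendsto`. -/
theorem mul_one_sub_mul_eq {a c N N' T : PowerSeries ℝ} (hc : c * (1 + a) = 1)
    (hN' : N' * (1 - T) = 1) (hN : N * (1 - (a * c + T)) = 1) :
    N * (1 - a * (N' - 1)) = (1 + a) * (1 + (N' - 1)) := by
  linear_combination (1 + a) * N' * hN - N * (1 + a) * hN' + N * N' * a * hc

theorem Supercritical.inv_mul {a : PowerSeries ℝ} (ha : Supercritical a) :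
    (1 + a)⁻¹ * (1 + a) = 1 :=
  PowerSeries.inv_mul_cancel _ (by simp [ha.constantCoeff_eq_zero])

variable {ι : Type u} {a : ι → PowerSeries ℝ}

theorem exists_inv_one_sub_sum (ha : ∀ i, Supercritical (a i)) (S : Finset ι) :
    ∃ N, N * (1 - ∑ i ∈ S, a i * (1 + a i)⁻¹) = 1 :=
  ⟨_, PowerSeries.inv_mul_cancel _ (by simp [(ha _).constantCoeff_eq_zero])⟩

/-- Factors are merged one at a time by `Supercritical.combine`; each merger produces a quadratic
term. -/
theorem supercritical_of_finset (ha : ∀ i, Supercritical (a i)) (S : Finset ι)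
    (hS : S.Nonempty) (N : PowerSeries ℝ) (hN : N * (1 - ∑ i ∈ S, a i * (1 + a i)⁻¹) = 1) :
    Supercritical (N - 1) ∧ (2 ≤ S.card → 0 < coeff 2 (N - 1)) := by
  classical
  induction hS using Finset.Nonempty.cons_induction generalizing N with
  | singleton i =>
    rw [Finset.sum_singleton] at hN
    have : N - 1 = a i := by
      linear_combination (1 + a i) * hN + N * a i * (ha i).inv_mul
    rw [this]
    exact ⟨ha i, fun h => by simp at h⟩
  | cons i S hi hS ih =>
    rw [Finset.sum_cons] at hN
    obtain ⟨N', hN'⟩ := exists_inv_one_sub_sum ha S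
    have := (ha i).combine (ih N' hN').1 (mul_one_sub_mul_eq (ha i).inv_mul hN' hN)
    exact ⟨this.1, fun _ => this.2⟩

theorem tendsto_coeff_of_family [Fintype ι] (ha : ∀ i, Supercritical (a i))
    (hι : 2 ≤ Fintype.card ι) (h2 : 3 ≤ Fintype.card ι ∨ ∃ i, 0 < coeff 2 (a i))
    {N : PowerSeries ℝ} (hN : N * (1 - ∑ i, a i * (1 + a i)⁻¹) = 1) :
    ∃ ρ, 0 < ρ ∧ ∃ A : ℝ, 0 < A ∧ Tendsto (fun n => coeff n N * ρ ^ n) atTop (𝓝 A) := by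
  classical
  -- The factor to be split off: arbitrary if there are three or more, since merging the others
  -- creates a quadratic term, and otherwise one with a quadratic term of its own.
  obtain ⟨i, hi⟩ : ∃ i, 3 ≤ Fintype.card ι ∨ 0 < coeff 2 (a i) := by
    rcases h2 with h | ⟨i, hi⟩
    · have : Nonempty ι := Fintype.card_pos_iff.1 (by omega)
      exact ⟨Classical.arbitrary ι, Or.inl h⟩
    · exact ⟨i, Or.inr hi⟩
  have hcard : (Finset.univ.erase i).card + 1 = Fintype.card ι :=
    Finset.card_erase_add_one (Finset.mem_univ i)
  have hne : (Finset.univ.erase i).Nonempty := Finset.card_pos.1 (by omega)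
  obtain ⟨N', hN'⟩ := exists_inv_one_sub_sum ha (Finset.univ.erase i)
  rw [← Finset.add_sum_erase _ _ (Finset.mem_univ i)] at hN
  obtain ⟨hsup, hpos⟩ := supercritical_of_finset ha _ hne N' hN'
  refine (ha i).combine_tendsto hsup (mul_one_sub_mul_eq (ha i).inv_mul hN' hN) ?_
  rcases hi with h | h
  · exact Or.inr (hpos (by omega))
  · exact Or.inl h

/-- Two linear series with the same slope. -/
theorem tendsto_coeff_of_linear {d : ℝ} (hd : 0 < d) {N : PowerSeries ℝ}
    (hN : N * (1 - C d * X) = 1 + C d * X) :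
    Tendsto (fun n => coeff n N * (d⁻¹) ^ n) atTop (𝓝 2) := by
  have hrec : ∀ n, coeff (n + 1) N = d * coeff n N + if n = 0 then d else 0 := by
    intro n
    have h := congrArg (coeff (n + 1)) hN
    have hx : N * (1 - C d * X) = N - C d * (N * X) := by ring
    rw [hx, map_sub, coeff_C_mul, coeff_succ_mul_X, map_add, coeff_one, coeff_C_mul, coeff_X,
      if_neg (Nat.succ_ne_zero n)] at h
    rw [← sub_eq_iff_eq_add', h]
    simp
  have h0 : coeff 0 N = 1 := by
    have h := congrArg (coeff 0) hN
    simpa using h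
  have hsucc : ∀ n, coeff (n + 1) N = 2 * d ^ (n + 1) := by
    intro n
    induction n with
    | zero =>
      rw [hrec, h0, if_pos rfl]
      ring
    | succ n ih =>
      rw [hrec, ih, if_neg (Nat.succ_ne_zero n)]
      ring
  refine tendsto_const_nhds.congr' ?_
  filter_upwards [eventually_ge_atTop 1] with n hn
  obtain ⟨m, rfl⟩ := Nat.exists_eq_add_of_le' hn
  rw [hsucc, mul_assoc, ← mul_pow, mul_inv_cancel₀ hd.ne', one_pow, mul_one]

end Families

/-! ### Factors without two-step walks are stars. -/

section Star

variable {W : Type u} {G : SimpleGraph W} {o : W}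

theorem adj_root_of_sawCount_two_eq_zero (hfin : ∀ x, (G.neighborSet x).Finite)
    (hconn : G.Connected) (h2 : sawCount G o 2 = 0) :
    IsStarAt G o ∧ ∀ x, x ≠ o → G.Adj o x := by
  rw [sawCount_eq_ncard, Set.ncard_eq_zero (finite_saws hfin o 2)] at h2
  have hno : ∀ x y, G.Adj o x → G.Adj x y → y = o := by
    intro x y hox hxy
    by_contra hyo
    have : [y, x, o] ∈ saws G o 2 := by
      refine cons_mem_saws.2 ⟨hxy.symm, ?_, cons_mem_saws.2 ⟨hox.symm, ?_, mem_saws_zero.2 rfl⟩⟩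
      · simpa using ⟨hxy.ne.symm, hyo⟩
      · simpa using hox.ne.symm
    rw [h2] at this
    exact this
  -- Being equal or adjacent to `o` propagates along walks, because a neighbour of `o` has no
  -- neighbour but `o`.
  have hall : ∀ x y (p : G.Walk x y), (x = o ∨ G.Adj o x) → (y = o ∨ G.Adj o y) := by
    intro x y p
    induction p with
    | nil => exact id
    | cons h p ih =>
      rintro (rfl | hx)
      · exact ih (Or.inr h)
      · exact ih (Or.inl (hno _ _ hx h))
  have hadj : ∀ x, x ≠ o → G.Adj o x := by
    intro x hx
    obtain ⟨p⟩ := hconn.preconnected o x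
    exact (hall o x p (Or.inl rfl)).resolve_left hx
  refine ⟨fun x y hxy => ?_, hadj⟩
  by_cases hx : x = o
  · exact Or.inl hx
  · exact Or.inr (hno x y (hadj x hx) hxy)

theorem card_eq_sawCount_one_add_one (hfin : ∀ x, (G.neighborSet x).Finite)
    (h : ∀ x, x ≠ o → G.Adj o x) : Nat.card W = sawCount G o 1 + 1 := by
  rw [sawCount_one, ← Set.ncard_univ, ← Set.ncard_insert_of_notMem (a := o) (by simp) (hfin o)]
  congr 1
  refine (Set.eq_univ_of_forall fun x => ?_).symm
  by_cases hx : x = o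
  · exact Set.mem_insert_iff.2 (Or.inl hx)
  · exact Set.mem_insert_of_mem _ (h x hx)

open PowerSeries in
theorem sawSeries_sub_one_eq_linear (hfin : ∀ x, (G.neighborSet x).Finite)
    (h2 : sawCount G o 2 = 0) : sawSeries G o - 1 = C (sawCount G o 1 : ℝ) * X := by
  ext n
  rw [map_sub, coeff_sawSeries, coeff_one, coeff_C_mul, coeff_X]
  match n with
  | 0 => simp [sawCount_zero]
  | 1 => simp
  | n + 2 =>
    have : sawCount G o (n + 2) = 0 := sawCount_eq_zero_of_le hfin (by omega) h2
    simp [this]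

end Star

/-! ### From the limit of `σ_n ρ ^ n` to the connective constant and the critical exponent. -/

section Asymptotics

variable {W : Type u} {G : SimpleGraph W} {o : W}

theorem isConnectiveConstant_of_tendsto {ρ A : ℝ} (hρ : 0 < ρ) (hA : 0 < A)
    (h : Tendsto (fun n => (sawCount G o n : ℝ) * ρ ^ n) atTop (𝓝 A)) :
    IsConnectiveConstant G o ρ⁻¹ := by
  have h1 := (h.rpow tendsto_one_div_atTop_nhds_zero_nat (Or.inl hA.ne')).mul_const ρ⁻¹
  rw [Real.rpow_zero, one_mul] at h1
  refine h1.congr' ?_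
  filter_upwards [eventually_ge_atTop 1] with n hn
  have hn' : (n : ℝ) ≠ 0 := by
    have : n ≠ 0 := by omega
    exact_mod_cast this
  rw [Real.mul_rpow (by positivity) (by positivity), ← Real.rpow_natCast ρ n,
    ← Real.rpow_mul hρ.le, mul_one_div_cancel hn', Real.rpow_one, mul_assoc,
    mul_inv_cancel₀ hρ.ne', mul_one]

theorem tendsto_sawCount_div {ρ A : ℝ} (hρ : 0 < ρ) (hA : 0 < A)
    (h : Tendsto (fun n => (sawCount G o n : ℝ) * ρ ^ n) atTop (𝓝 A)) :
    Tendsto (fun n => (sawCount G o n : ℝ) / (A * ρ⁻¹ ^ n)) atTop (𝓝 1) := by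
  have h1 := h.div_const A
  rw [div_self hA.ne'] at h1
  refine h1.congr fun n => ?_
  rw [inv_pow]
  field_simp

theorem isCriticalExponent_iff_of_tendsto {ρ A : ℝ} (hρ : 0 < ρ) (hA : 0 < A)
    (h : Tendsto (fun n => (sawCount G o n : ℝ) * ρ ^ n) atTop (𝓝 A)) (γ : ℝ) :
    IsCriticalExponent G o γ ↔ γ = 1 := by
  have hconst := isConnectiveConstant_of_tendsto hρ hA h
  constructor
  · rintro ⟨μ, hμ, B, hB, hlim⟩
    obtain rfl := tendsto_nhds_unique hμ hconst
    -- Dividing the two asymptotics leaves `n ^ (1 - γ)` with a finite positive limit, which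
    -- excludes both `γ < 1` and `γ > 1`.
    have hpow : Tendsto (fun n : ℕ => (n : ℝ) ^ (1 - γ)) atTop (𝓝 (A / B)) := by
      have h1 := (h.div_const B).div hlim one_ne_zero
      rw [div_one] at h1
      refine h1.congr' ?_
      filter_upwards [eventually_ge_atTop 1, h.eventually (lt_mem_nhds hA)] with n hn hpos
      have hn' : (0 : ℝ) < n := by exact_mod_cast hn
      have hs : (0 : ℝ) < sawCount G o n := pos_of_mul_pos_left hpos (by positivity)
      simp only [Pi.div_apply]
      rw [inv_pow]
      field_simp
    by_contra hγ
    rcases lt_or_gt_of_ne hγ with hlt | hgt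
    · have h1 := (tendsto_rpow_atTop (y := 1 - γ) (by linarith)).comp
        (tendsto_natCast_atTop_atTop (R := ℝ))
      exact not_tendsto_nhds_of_tendsto_atTop h1 _ hpow
    · have h1 := (tendsto_rpow_neg_atTop (y := γ - 1) (by linarith)).comp
        (tendsto_natCast_atTop_atTop (R := ℝ))
      rw [neg_sub] at h1
      have := tendsto_nhds_unique hpow h1
      exact (div_pos hA hB).ne' this
  · rintro rfl
    refine ⟨ρ⁻¹, hconst, A, hA, ?_⟩
    simpa using tendsto_sawCount_div hρ hA h

end Asymptotics

/-! ### Assembly of the main theorem. -/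

open PowerSeries in
theorem tendsto_sawCount_freeProduct {ι : Type u} [Fintype ι] (hι : 2 ≤ Fintype.card ι)
    {V : ι → Type v} (G : ∀ i, SimpleGraph (V i)) (o : ∀ i, V i)
    (hnontrivial : ∀ i, Nontrivial (V i))
    (hfin : ∀ i x, ((G i).neighborSet x).Finite)
    (hconn : ∀ i, (G i).Connected) (hqt : ∀ i, IsQuasiTransitive (G i))
    (hstar : ¬ (Fintype.card ι = 2 ∧ (∀ i, IsStarAt (G i) (o i)) ∧
      ∃ i j, Nat.card (V i) ≠ Nat.card (V j))) :
    ∃ ρ, 0 < ρ ∧ ∃ A : ℝ, 0 < A ∧ Tendsto (fun n =>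
      (sawCount (freeProduct G o) (Word.empty o) n : ℝ) * ρ ^ n) atTop (𝓝 A) := by
  simp only [← coeff_sawSeries]
  have ha : ∀ i, Supercritical (sawSeries (G i) (o i) - 1) := fun i =>
    have := hnontrivial i
    supercritical_sawSeries_sub_one (hfin i) (hconn i) (hqt i) (o i)
  have hN := sawSeries_freeProduct (o := o) hfin
  have hN' : sawSeries (freeProduct G o) (Word.empty o) *
      (1 - ∑ i, (sawSeries (G i) (o i) - 1) * (1 + (sawSeries (G i) (o i) - 1))⁻¹) = 1 := by
    simpa only [add_sub_cancel] using hN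
  by_cases h2 : 3 ≤ Fintype.card ι ∨ ∃ i, 0 < coeff 2 (sawSeries (G i) (o i) - 1)
  · exact tendsto_coeff_of_family ha hι h2 hN'
  -- Only two stars rooted at their centres remain. By `hstar` they have equally many leaves, so
  -- both series are `d X`.
  · push Not at h2
    obtain ⟨hcard, hcoeff⟩ := h2
    have hcard2 : Fintype.card ι = 2 := by omega
    have hzero : ∀ i, sawCount (G i) (o i) 2 = 0 := by
      intro i
      have := hcoeff i
      rw [map_sub, coeff_sawSeries, coeff_one, if_neg two_ne_zero, sub_zero] at this
      exact_mod_cast le_antisymm this (Nat.cast_nonneg _)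
    have hroot := fun i => adj_root_of_sawCount_two_eq_zero (hfin i) (hconn i) (hzero i)
    have heq : ∀ i j, Nat.card (V i) = Nat.card (V j) := by
      by_contra! hne
      exact hstar ⟨hcard2, fun i => (hroot i).1, hne⟩
    have : Nonempty ι := Fintype.card_pos_iff.1 (by omega)
    let i₀ := Classical.arbitrary ι
    have hdeg : ∀ i, sawCount (G i) (o i) 1 = sawCount (G i₀) (o i₀) 1 := by
      intro i
      have := heq i i₀
      rw [card_eq_sawCount_one_add_one (hfin i) (hroot i).2,
        card_eq_sawCount_one_add_one (hfin i₀) (hroot i₀).2] at this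
      omega
    let d : ℝ := (sawCount (G i₀) (o i₀) 1 : ℝ)
    have hdpos : 0 < d := by
      have := hnontrivial i₀
      exact Nat.cast_pos.2 (sawCount_one_pos (hfin i₀) (hconn i₀) (o i₀))
    have hlin : ∀ i, sawSeries (G i) (o i) - 1 = C d * X := by
      intro i
      rw [sawSeries_sub_one_eq_linear (hfin i) (hzero i), hdeg i]
    have hinv := (ha i₀).inv_mul
    simp only [hlin] at hN' hinv
    rw [Finset.sum_const, Finset.card_univ, hcard2, two_nsmul] at hN'
    refine ⟨d⁻¹, inv_pos.2 hdpos, 2, two_pos, tendsto_coeff_of_linear hdpos ?_⟩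
    linear_combination (1 + C d * X) * hN' +
      2 * C d * X * sawSeries (freeProduct G o) (Word.empty o) * hinv

end FreeProductSAW

theorem theorem4p1 {ι : Type*} [Fintype ι] (hι : 2 ≤ Fintype.card ι)
    {V : ι → Type*} (G : ∀ i, SimpleGraph (V i)) (o : ∀ i, V i)
    (hnontrivial : ∀ i, Nontrivial (V i))
    (hfin : ∀ i x, ((G i).neighborSet x).Finite)
    (hconn : ∀ i, (G i).Connected)
    (hqt : ∀ i, FreeProductSAW.IsQuasiTransitive (G i))
    (hstar : ¬ (Fintype.card ι = 2 ∧ (∀ i, FreeProductSAW.IsStarAt (G i) (o i)) ∧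
      ∃ i j, Nat.card (V i) ≠ Nat.card (V j))) :
    (∃ μ : ℝ, FreeProductSAW.IsConnectiveConstant (FreeProductSAW.freeProduct G o)
        (FreeProductSAW.Word.empty o) μ ∧
      ∃ A : ℝ, 0 < A ∧
        Tendsto (fun n : ℕ => (FreeProductSAW.sawCount (FreeProductSAW.freeProduct G o)
          (FreeProductSAW.Word.empty o) n : ℝ) / (A * μ ^ n)) atTop (𝓝 1)) ∧
    ∀ γ : ℝ, FreeProductSAW.IsCriticalExponent (FreeProductSAW.freeProduct G o)
      (FreeProductSAW.Word.empty o) γ ↔ γ = 1 := by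
  obtain ⟨ρ, hρ, A, hA, h⟩ :=
    FreeProductSAW.tendsto_sawCount_freeProduct hι G o hnontrivial hfin hconn hqt hstar
  exact ⟨⟨ρ⁻¹, FreeProductSAW.isConnectiveConstant_of_tendsto hρ hA h, A, hA,
    FreeProductSAW.tendsto_sawCount_div hρ hA h⟩,
    FreeProductSAW.isCriticalExponent_iff_of_tendsto hρ hA h⟩
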